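/- Let $(M^m,g)$ and $(N^{m+1},h)$ be smooth Riemannian manifolds (without boundary), let $\varphi:(M,g)\to(N,h)$ be a smooth isometric immersion as a hypersurface, and let $\xi$ be a smooth unit normal vector field along $\varphi$. Let $\nabla$ and $\nabla^h$ be the Levi-Civita connections of $M$ and $N$, let $\overline\nabla$ be the connection induced by $\nabla^h$ on $\varphi^{-1}TN$, and let $\{e_i\}$ denote local orthonormal frames of $M$. Put $$B_\varphi(X,Y)=\overline\nabla_X(d\varphi(Y))-d\varphi(\nabla_XY),\qquad \tau(\varphi)=\sum_{i=1}^m B_\varphi(e_i,e_i),\qquad \|B_\varphi\|^2=\sum_{j,k=1}^m\|B_\varphi(e_j,e_k)\|^2,$$ $$R^h(U,V)W=\nabla^h_U\nabla^h_VW-\nabla^h_V\nabla^h_UW-\nabla^h_{[U,V]}W,\qquad \rho^h(u)=\sum_{i=1}^{m+1}R^h(u,e_i')e_i'$$ with $\{e'_i\}$ an orthonormal basis of the tangent space of $N$ at the base point of $u$. For a vector field $V$ along $\varphi$ let $\overline\Delta V=-\sum_{i}\{\overline\nabla_{e_i}\overline\nabla_{e_i}V-\overline\nabla_{\nabla_{e_i}e_i}V\}$,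 and let $$\tau_2(\varphi)=\overline\Delta(\tau(\varphi))-\sum_{i=1}^mR^h(\tau(\varphi),d\varphi(e_i))\,d\varphi(e_i).$$ The map $\varphi$ is called harmonic if $\tau(\varphi)=0$ and biharmonic if $\tau_2(\varphi)=0$. Assume that the mean curvature $\mathbf H=\frac1m h(\tau(\varphi),\xi)$ is constant on $M$. Then: (1) If $\mathbf H\neq0$, then $\varphi$ is biharmonic if and only if $\rho^h(\xi)=\|B_\varphi\|^2\,\xi$ on $M$. (2) If $\mathbf H\ne0$ and $(N,h)$ is Einstein, i.e. $\rho^h=c\,\mathrm{Id}$ for a constant $c$, then $\varphi$ is biharmonic if and only if $\|B_\varphi\|^2=c$ on $M$. (3) If the Ricci curvature of $(N,h)$ is non-positive, i.e. $h(\rho^h(u),u)\le0$ for all tangent vectors $u$ of $N$, and $\varphi$ is biharmonic, then $\varphi$ is harmonic. (In particular, if moreover $\mathbf H\neq0$ and $M\neq\emptyset$, then $\varphi$ is not biharmonic.) -/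

import Mathlib

open Bundle
open scoped Manifold ContDiff

set_option linter.unusedSectionVars false

noncomputable section

namespace RiemGeom

open VectorField FiberBundle

section LeviCivita

variable {E : Type*} [NormedAddCommGroup E] [NormedSpace ℝ E] [FiniteDimensional ℝ E]
  {M : Type*} [TopologicalSpace M] [ChartedSpace E M] [IsManifold 𝓘(ℝ, E) ∞ M]
  [RiemannianBundle (fun x : M ↦ TangentSpace 𝓘(ℝ, E) x)]
  [IsContMDiffRiemannianBundle 𝓘(ℝ, E) ∞ E (fun x : M ↦ TangentSpace 𝓘(ℝ, E) x)]

/-- Half of the right-hand side of the Koszul formula. -/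
def koszul (X Y Z : Π x : M, TangentSpace 𝓘(ℝ, E) x) (x : M) : ℝ :=
  (1 / 2) * (mvfderiv 𝓘(ℝ, E) (fun y ↦ inner ℝ (Y y) (Z y)) x (X x)
    + mvfderiv 𝓘(ℝ, E) (fun y ↦ inner ℝ (X y) (Z y)) x (Y x)
    - mvfderiv 𝓘(ℝ, E) (fun y ↦ inner ℝ (X y) (Y y)) x (Z x)
    + inner ℝ (mlieBracket 𝓘(ℝ, E) X Y x) (Z x)
    - inner ℝ (mlieBracket 𝓘(ℝ, E) X Z x) (Y x)
    - inner ℝ (mlieBracket 𝓘(ℝ, E) Y Z x) (X x))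

lemma inner_mdiff {X Y : Π x : M, TangentSpace 𝓘(ℝ, E) x} {x : M}
    (hX : MDiffAt (T% X) x) (hY : MDiffAt (T% Y) x) :
    MDiffAt (fun y ↦ (inner ℝ (X y) (Y y) : ℝ)) x :=
  MDifferentiableAt.inner_bundle (IB := 𝓘(ℝ, E)) (F := E)
    (E := fun x : M ↦ TangentSpace 𝓘(ℝ, E) x) hX hY

lemma mvfderiv_inner_smul_left {X Y : Π x : M, TangentSpace 𝓘(ℝ, E) x} {f : M → ℝ} {x : M}
    (hf : MDiffAt f x) (hX : MDiffAt (T% X) x) (hY : MDiffAt (T% Y) x)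
    (v : TangentSpace 𝓘(ℝ, E) x) :
    mvfderiv 𝓘(ℝ, E) (fun y ↦ (inner ℝ ((f • X) y) (Y y) : ℝ)) x v =
      f x * mvfderiv 𝓘(ℝ, E) (fun y ↦ (inner ℝ (X y) (Y y) : ℝ)) x v
        + inner ℝ (X x) (Y x) * mvfderiv 𝓘(ℝ, E) f x v := by
  have : (fun y ↦ (inner ℝ ((f • X) y) (Y y) : ℝ)) = f * (fun y ↦ (inner ℝ (X y) (Y y) : ℝ)) := by
    ext y; simp [inner_smul_left]
  rw [this, mvfderiv_mul hf (inner_mdiff hX hY)]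
  simp

lemma mvfderiv_inner_add_left {X X' Y : Π x : M, TangentSpace 𝓘(ℝ, E) x} {x : M}
    (hX : MDiffAt (T% X) x) (hX' : MDiffAt (T% X') x) (hY : MDiffAt (T% Y) x)
    (v : TangentSpace 𝓘(ℝ, E) x) :
    mvfderiv 𝓘(ℝ, E) (fun y ↦ (inner ℝ ((X + X') y) (Y y) : ℝ)) x v =
      mvfderiv 𝓘(ℝ, E) (fun y ↦ (inner ℝ (X y) (Y y) : ℝ)) x v
        + mvfderiv 𝓘(ℝ, E) (fun y ↦ (inner ℝ (X' y) (Y y) : ℝ)) x v := by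
  have : (fun y ↦ (inner ℝ ((X + X') y) (Y y) : ℝ))
      = (fun y ↦ (inner ℝ (X y) (Y y) : ℝ)) + (fun y ↦ (inner ℝ (X' y) (Y y) : ℝ)) := by
    ext y; simp [inner_add_left]
  rw [this, mvfderiv_add (inner_mdiff hX hY) (inner_mdiff hX' hY)]
  simp

lemma mvfderiv_inner_comm (X Y : Π x : M, TangentSpace 𝓘(ℝ, E) x) (x : M) :
    mvfderiv 𝓘(ℝ, E) (fun y ↦ (inner ℝ (X y) (Y y) : ℝ)) x =
      mvfderiv 𝓘(ℝ, E) (fun y ↦ (inner ℝ (Y y) (X y) : ℝ)) x := by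
  congr 1; ext y; exact real_inner_comm _ _

/-- `koszul` is tensorial in its first argument. -/
lemma koszul_tensorial_fst {Y Z : Π x : M, TangentSpace 𝓘(ℝ, E) x} {x : M}
    (hY : MDiffAt (T% Y) x) (hZ : MDiffAt (T% Z) x) :
    TensorialAt 𝓘(ℝ, E) E (fun X : Π x : M, TangentSpace 𝓘(ℝ, E) x ↦ koszul X Y Z x) x where
  smul {f X} hf hX := by
    simp only [koszul]
    rw [mvfderiv_inner_smul_left hf hX hZ, mvfderiv_inner_smul_left hf hX hY,
      mlieBracket_smul_left hf hX, mlieBracket_smul_left hf hX]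
    simp only [Pi.smul_apply', inner_add_left, inner_smul_left,
      inner_smul_right, map_smul, smul_eq_mul, conj_trivial]
    ring
  add {X X'} hX hX' := by
    simp only [koszul]
    rw [mvfderiv_inner_add_left hX hX' hZ, mvfderiv_inner_add_left hX hX' hY,
      mlieBracket_add_left hX hX', mlieBracket_add_left hX hX']
    simp only [Pi.add_apply, inner_add_left, inner_add_right, map_add]
    ring

/-- `koszul` is tensorial in its third argument. -/
lemma koszul_tensorial_thd {X Y : Π x : M, TangentSpace 𝓘(ℝ, E) x} {x : M}
    (hX : MDiffAt (T% X) x) (hY : MDiffAt (T% Y) x) :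
    TensorialAt 𝓘(ℝ, E) E (fun Z : Π x : M, TangentSpace 𝓘(ℝ, E) x ↦ koszul X Y Z x) x where
  smul {f Z} hf hZ := by
    simp only [koszul]
    rw [mvfderiv_inner_comm Y (f • Z), mvfderiv_inner_comm X (f • Z),
      mvfderiv_inner_smul_left hf hZ hX, mvfderiv_inner_smul_left hf hZ hY,
      mvfderiv_inner_comm Y Z, mvfderiv_inner_comm X Z,
      mlieBracket_smul_right hf hZ, mlieBracket_smul_right hf hZ]
    simp only [Pi.smul_apply', inner_add_left, inner_smul_left,
      inner_smul_right, map_smul, smul_eq_mul, conj_trivial]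
    ring
  add {Z Z'} hZ hZ' := by
    simp only [koszul]
    rw [mvfderiv_inner_comm Y (Z + Z'), mvfderiv_inner_comm X (Z + Z'),
      mvfderiv_inner_add_left hZ hZ' hX, mvfderiv_inner_add_left hZ hZ' hY,
      mvfderiv_inner_comm Y Z, mvfderiv_inner_comm X Z, mvfderiv_inner_comm Y Z',
      mvfderiv_inner_comm X Z',
      mlieBracket_add_right hZ hZ', mlieBracket_add_right hZ hZ']
    simp only [Pi.add_apply, inner_add_left, inner_add_right, map_add]
    ring

lemma koszul_add {X Y Y' Z : Π x : M, TangentSpace 𝓘(ℝ, E) x} {x : M} (hX : MDiffAt (T% X) x)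
    (hY : MDiffAt (T% Y) x) (hY' : MDiffAt (T% Y') x) (hZ : MDiffAt (T% Z) x) :
    koszul X (Y + Y') Z x = koszul X Y Z x + koszul X Y' Z x := by
  simp only [koszul]
  rw [mvfderiv_inner_comm X (Y + Y'), mvfderiv_inner_comm X Y,
    mvfderiv_inner_comm X Y', mvfderiv_inner_add_left hY hY' hZ, mvfderiv_inner_add_left hY hY' hX,
    mlieBracket_add_right hY hY', mlieBracket_add_left hY hY']
  simp only [Pi.add_apply, inner_add_left, inner_add_right, map_add]
  ring

lemma koszul_smul {X Y Z : Π x : M, TangentSpace 𝓘(ℝ, E) x} {f : M → ℝ} {x : M}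
    (hf : MDiffAt f x) (hX : MDiffAt (T% X) x)
    (hY : MDiffAt (T% Y) x) (hZ : MDiffAt (T% Z) x) :
    koszul X (f • Y) Z x =
      f x * koszul X Y Z x + mvfderiv 𝓘(ℝ, E) f x (X x) * inner ℝ (Y x) (Z x) := by
  simp only [koszul]
  rw [mvfderiv_inner_comm X (f • Y), mvfderiv_inner_comm X Y,
    mvfderiv_inner_smul_left hf hY hX, mvfderiv_inner_smul_left hf hY hZ,
    mlieBracket_smul_right hf hY, mlieBracket_smul_left hf hY]
  simp only [Pi.smul_apply', inner_add_left,
    inner_smul_left, inner_smul_right, map_smul, smul_eq_mul, conj_trivial]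
  ring

instance finiteDimensional_tangentSpace (x : M) :
    FiniteDimensional ℝ (TangentSpace 𝓘(ℝ, E) x) :=
  inferInstanceAs (FiniteDimensional ℝ E)

instance completeSpace_tangentSpace (x : M) : CompleteSpace (TangentSpace 𝓘(ℝ, E) x) :=
  FiniteDimensional.complete ℝ _

open Classical in
/-- The operator `Y ↦ (v ↦ ∇_v Y)` determined by the Koszul formula. -/
def koszulCov (Y : Π x : M, TangentSpace 𝓘(ℝ, E) x) (x : M) :
    TangentSpace 𝓘(ℝ, E) x →L[ℝ] TangentSpace 𝓘(ℝ, E) x :=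
  if hY : MDiffAt (T% Y) x then
    (InnerProductSpace.toDual ℝ
        (TangentSpace 𝓘(ℝ, E) x)).symm.toContinuousLinearEquiv.toContinuousLinearMap ∘L
      TensorialAt.mkHom₂ (I := 𝓘(ℝ, E)) (F := E) (F' := E) (fun X Z ↦ koszul X Y Z x) x
        (fun _ hZ ↦ koszul_tensorial_fst hY hZ) (fun _ hX ↦ koszul_tensorial_thd hX hY)
  else 0

lemma inner_koszulCov {X Y Z : Π x : M, TangentSpace 𝓘(ℝ, E) x} {x : M} (hX : MDiffAt (T% X) x)
    (hY : MDiffAt (T% Y) x) (hZ : MDiffAt (T% Z) x) :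
    inner ℝ (koszulCov Y x (X x)) (Z x) = koszul X Y Z x := by
  rw [koszulCov, dif_pos hY]
  simp only [ContinuousLinearMap.comp_apply]
  erw [InnerProductSpace.toDual_symm_apply]
  exact TensorialAt.mkHom₂_apply (I := 𝓘(ℝ, E)) (F := E) (F' := E)
    (fun _ hZ ↦ koszul_tensorial_fst hY hZ) (fun _ hX ↦ koszul_tensorial_thd hX hY) hX hZ

/-- Existence of the Levi-Civita connection: a metric torsion-free covariant derivative on `TM`. -/
theorem exists_leviCivita :
    ∃ cov : CovariantDerivative 𝓘(ℝ, E) E (fun x : M ↦ TangentSpace 𝓘(ℝ, E) x),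
      cov.IsMetricCompatible ∧ cov.torsion = 0 := by
  have key {x : M} {v w : TangentSpace 𝓘(ℝ, E) x}
      (h : ∀ Z : Π x : M, TangentSpace 𝓘(ℝ, E) x, MDiffAt (T% Z) x →
        inner ℝ v (Z x) = inner ℝ w (Z x)) : v = w := by
    refine ext_inner_right ℝ fun z ↦ ?_
    simpa using h (extend E z) (mdifferentiableAt_extend 𝓘(ℝ, E) E z)
  refine ⟨⟨koszulCov, ⟨?_, ?_⟩⟩, ?_, ?_⟩
  · intro Y Y' x hY hY' _
    ext1 v
    refine key fun Z hZ ↦ ?_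
    have hX := mdifferentiableAt_extend 𝓘(ℝ, E) E v
    have h := koszul_add hX hY hY' hZ
    rw [← inner_koszulCov hX hY hZ, ← inner_koszulCov hX hY' hZ,
      ← inner_koszulCov hX (mdifferentiableAt_add_section hY hY') hZ] at h
    simpa [inner_add_left] using h
  · intro Y f x hY hf _
    ext1 v
    refine key fun Z hZ ↦ ?_
    have hX := mdifferentiableAt_extend 𝓘(ℝ, E) E v
    have h := koszul_smul hf hX hY hZ
    rw [← inner_koszulCov hX hY hZ,
      ← inner_koszulCov hX (hf.smul_section hY) hZ] at h
    simpa [inner_add_left, inner_smul_left] using h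
  · rw [CovariantDerivative.isMetricCompatible_iff]
    intro x X Y Z hX hY hZ
    have h1 := inner_koszulCov hX hY hZ
    have h2 := inner_koszulCov hX hZ hY
    rw [real_inner_comm] at h2
    simp only
    rw [h1, h2]
    simp only [koszul, mvfderiv_inner_comm Z Y, mvfderiv_inner_comm X Z, mvfderiv_inner_comm X Y,
      mlieBracket_swap_apply (V := Z) (W := Y), inner_neg_left]
    ring
  · rw [CovariantDerivative.torsion_eq_zero_iff]
    intro X Y x hX hY
    refine key fun Z hZ ↦ ?_
    have h1 := inner_koszulCov hX hY hZ
    have h2 := inner_koszulCov hY hX hZ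
    rw [inner_sub_left]
    simp only
    rw [h1, h2]
    simp only [koszul, mvfderiv_inner_comm Y X,
      mlieBracket_swap_apply (V := Y) (W := X), inner_neg_left]
    ring

variable (M) in
/-- The Levi-Civita connection of a Riemannian manifold: the metric torsion-free covariant
derivative on the tangent bundle. As these two properties determine `∇ Y` at every point at which
`Y` is differentiable, the choice is immaterial. The value `leviCivita M Y x v` is `(∇_v Y)(x)`. -/
def leviCivita : CovariantDerivative 𝓘(ℝ, E) E (fun x : M ↦ TangentSpace 𝓘(ℝ, E) x) :=
  Classical.choose exists_leviCivita

lemma leviCivita_isMetricCompatible :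
    CovariantDerivative.IsMetricCompatible (V := fun x : M ↦ TangentSpace 𝓘(ℝ, E) x)
      (leviCivita M) :=
  (Classical.choose_spec exists_leviCivita).1

lemma leviCivita_torsion :
    CovariantDerivative.torsion (I := 𝓘(ℝ, E)) (leviCivita M) = 0 :=
  (Classical.choose_spec exists_leviCivita).2

/-- The curvature tensor `R(u, v)w = ∇_u ∇_v w - ∇_v ∇_u w - ∇_[u, v] w`, computed with local
extensions of `u`, `v`, `w` to vector fields that are smooth near `x` (by tensoriality, the choice
of the extensions is immaterial). -/
def curvature (x : M) (u v w : TangentSpace 𝓘(ℝ, E) x) : TangentSpace 𝓘(ℝ, E) x :=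
  leviCivita M (fun y ↦ leviCivita M (extend E w) y (extend E v y)) x u
    - leviCivita M (fun y ↦ leviCivita M (extend E w) y (extend E u y)) x v
    - leviCivita M (extend E w) x (mlieBracket 𝓘(ℝ, E) (extend E u) (extend E v) x)

/-- The Ricci transform `ρ(u) = ∑ i, R(u, e i) (e i)`, for an orthonormal basis `e` of `T_x M`. -/
def ricciTransform (x : M) (u : TangentSpace 𝓘(ℝ, E) x) : TangentSpace 𝓘(ℝ, E) x :=
  ∑ i, curvature x u (stdOrthonormalBasis ℝ (TangentSpace 𝓘(ℝ, E) x) i)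
    (stdOrthonormalBasis ℝ (TangentSpace 𝓘(ℝ, E) x) i)

variable (E M) in
/-- Einstein with constant `c`: the Ricci transform is `c` times the identity. -/
def IsEinstein (c : ℝ) : Prop :=
  ∀ (x : M) (u : TangentSpace 𝓘(ℝ, E) x), ricciTransform x u = c • u

variable (E M) in
/-- Non-positive Ricci curvature: `Ric(u, u) = ⟨ρ(u), u⟩ ≤ 0` for all tangent vectors `u`. -/
def HasNonposRicci : Prop :=
  ∀ (x : M) (u : TangentSpace 𝓘(ℝ, E) x), inner ℝ (ricciTransform x u) u ≤ 0

end LeviCivita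

section Maps

variable {E : Type*} [NormedAddCommGroup E] [NormedSpace ℝ E] [FiniteDimensional ℝ E]
  {M : Type*} [TopologicalSpace M] [ChartedSpace E M] [IsManifold 𝓘(ℝ, E) ∞ M]
  [RiemannianBundle (fun x : M ↦ TangentSpace 𝓘(ℝ, E) x)]
  [IsContMDiffRiemannianBundle 𝓘(ℝ, E) ∞ E (fun x : M ↦ TangentSpace 𝓘(ℝ, E) x)]
  {F : Type*} [NormedAddCommGroup F] [NormedSpace ℝ F] [FiniteDimensional ℝ F]
  {N : Type*} [TopologicalSpace N] [ChartedSpace F N] [IsManifold 𝓘(ℝ, F) ∞ N]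
  [RiemannianBundle (fun y : N ↦ TangentSpace 𝓘(ℝ, F) y)]
  [IsContMDiffRiemannianBundle 𝓘(ℝ, F) ∞ F (fun y : N ↦ TangentSpace 𝓘(ℝ, F) y)]

/-- The connection `∇̄` induced on `φ⁻¹TN` by the Levi-Civita connection of `N`:
`pullbackCov φ V x v = (∇̄_v V)(x)` for a vector field `V` along `φ`. In terms of the local frame
`E_a` of `TN` that is constant in the preferred trivialization of `TN` at `φ x`, writing
`V = ∑ V^a (E_a ∘ φ)` near `x`, it is the usual
`∑ dV^a(v) E_a(φ x) + ∑ V^a(x) ∇_{dφ v} E_a`; here `extend F (V x)` is the local vector field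
`∑ V^a(x) E_a` on `N`. -/
def pullbackCov (φ : M → N) (V : Π x : M, TangentSpace 𝓘(ℝ, F) (φ x)) (x : M) :
    TangentSpace 𝓘(ℝ, E) x →L[ℝ] TangentSpace 𝓘(ℝ, F) (φ x) :=
  (trivializationAt F (fun y : N ↦ TangentSpace 𝓘(ℝ, F) y) (φ x)).symmL ℝ (φ x) ∘L
      mvfderiv 𝓘(ℝ, E)
        (fun x' ↦ (trivializationAt F (fun y : N ↦ TangentSpace 𝓘(ℝ, F) y) (φ x)
          ⟨φ x', V x'⟩).2) x
    + leviCivita N (extend F (V x)) (φ x) ∘L mfderiv 𝓘(ℝ, E) 𝓘(ℝ, F) φ x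

variable (E F) in
/-- The second fundamental form `B_φ(u, v) = ∇̄_u (dφ(v)) - dφ(∇_u v)` of a map `φ`, computed with
a local extension of `v` to a vector field that is smooth near `x`. -/
def secondFundamentalForm (φ : M → N) (x : M) (u v : TangentSpace 𝓘(ℝ, E) x) :
    TangentSpace 𝓘(ℝ, F) (φ x) :=
  pullbackCov φ (fun x' ↦ mfderiv 𝓘(ℝ, E) 𝓘(ℝ, F) φ x' (extend E v x')) x u
    - mfderiv 𝓘(ℝ, E) 𝓘(ℝ, F) φ x (leviCivita M (extend E v) x u)

variable (E F) in
/-- The tension field `τ(φ) = ∑ i, B_φ(e i, e i)`. -/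
def tension (φ : M → N) (x : M) : TangentSpace 𝓘(ℝ, F) (φ x) :=
  ∑ i, secondFundamentalForm E F φ x (stdOrthonormalBasis ℝ (TangentSpace 𝓘(ℝ, E) x) i)
    (stdOrthonormalBasis ℝ (TangentSpace 𝓘(ℝ, E) x) i)

variable (E F) in
/-- The squared norm `‖B_φ‖² = ∑ j k, ‖B_φ(e j, e k)‖²` of the second fundamental form. -/
def normSqSecondFundamentalForm (φ : M → N) (x : M) : ℝ :=
  ∑ j, ∑ k, ‖secondFundamentalForm E F φ x (stdOrthonormalBasis ℝ (TangentSpace 𝓘(ℝ, E) x) j)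
    (stdOrthonormalBasis ℝ (TangentSpace 𝓘(ℝ, E) x) k)‖ ^ 2

/-- The second covariant derivative `∇̄_u ∇̄_v V - ∇̄_{∇_u v} V` of a vector field `V` along `φ`,
computed with a local extension of `v` to a vector field that is smooth near `x`. -/
def secondCov (φ : M → N) (V : Π x : M, TangentSpace 𝓘(ℝ, F) (φ x)) (x : M)
    (u v : TangentSpace 𝓘(ℝ, E) x) : TangentSpace 𝓘(ℝ, F) (φ x) :=
  pullbackCov φ (fun x' ↦ pullbackCov φ V x' (extend E v x')) x u
    - pullbackCov φ V x (leviCivita M (extend E v) x u)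

variable (E F) in
/-- The rough Laplacian `Δ̄V = -∑ i, (∇̄_{e i} ∇̄_{e i} V - ∇̄_{∇_{e i} e i} V)`. -/
def roughLaplacian (φ : M → N) (V : Π x : M, TangentSpace 𝓘(ℝ, F) (φ x)) (x : M) :
    TangentSpace 𝓘(ℝ, F) (φ x) :=
  -∑ i, secondCov φ V x (stdOrthonormalBasis ℝ (TangentSpace 𝓘(ℝ, E) x) i)
    (stdOrthonormalBasis ℝ (TangentSpace 𝓘(ℝ, E) x) i)

variable (E F) in
/-- The curvature term `𝓡(V) = ∑ i, R^N(V, dφ(e i)) dφ(e i)` of the Jacobi operator. -/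
def curvatureTerm (φ : M → N) (V : Π x : M, TangentSpace 𝓘(ℝ, F) (φ x)) (x : M) :
    TangentSpace 𝓘(ℝ, F) (φ x) :=
  ∑ i, curvature (φ x) (V x)
    (mfderiv 𝓘(ℝ, E) 𝓘(ℝ, F) φ x (stdOrthonormalBasis ℝ (TangentSpace 𝓘(ℝ, E) x) i))
    (mfderiv 𝓘(ℝ, E) 𝓘(ℝ, F) φ x (stdOrthonormalBasis ℝ (TangentSpace 𝓘(ℝ, E) x) i))

variable (E F) in
/-- The bitension field `τ₂(φ) = Δ̄ τ(φ) - 𝓡(τ(φ))`. -/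
def bitension (φ : M → N) (x : M) : TangentSpace 𝓘(ℝ, F) (φ x) :=
  roughLaplacian E F φ (tension E F φ) x - curvatureTerm E F φ (tension E F φ) x

variable (E F) in
/-- A smooth map is harmonic if its tension field vanishes. -/
def IsHarmonic (φ : M → N) : Prop :=
  ContMDiff 𝓘(ℝ, E) 𝓘(ℝ, F) ∞ φ ∧ ∀ x : M, tension E F φ x = 0

variable (E F) in
/-- A smooth map is biharmonic if its bitension field vanishes. -/
def IsBiharmonic (φ : M → N) : Prop :=
  ContMDiff 𝓘(ℝ, E) 𝓘(ℝ, F) ∞ φ ∧ ∀ x : M, bitension E F φ x = 0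

variable (E F) in
/-- A smooth map whose differential preserves the Riemannian metrics (hence an immersion). -/
structure IsIsometricImmersion (φ : M → N) : Prop where
  contMDiff : ContMDiff 𝓘(ℝ, E) 𝓘(ℝ, F) ∞ φ
  inner_mfderiv : ∀ (x : M) (u v : TangentSpace 𝓘(ℝ, E) x),
    inner ℝ (mfderiv 𝓘(ℝ, E) 𝓘(ℝ, F) φ x u) (mfderiv 𝓘(ℝ, E) 𝓘(ℝ, F) φ x v) = inner ℝ u v

variable (E F) in
/-- A smooth unit normal vector field along `φ`. -/
structure IsUnitNormalField (φ : M → N) (ξ : Π x : M, TangentSpace 𝓘(ℝ, F) (φ x)) : Prop where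
  contMDiff : ContMDiff 𝓘(ℝ, E) 𝓘(ℝ, F).tangent ∞
    (fun x ↦ (⟨φ x, ξ x⟩ : TangentBundle 𝓘(ℝ, F) N))
  norm_eq_one : ∀ x : M, ‖ξ x‖ = 1
  inner_mfderiv_eq_zero : ∀ (x : M) (u : TangentSpace 𝓘(ℝ, E) x),
    inner ℝ (mfderiv 𝓘(ℝ, E) 𝓘(ℝ, F) φ x u) (ξ x) = 0

variable (E F) in
/-- The mean curvature `(1/m) h(τ(φ), ξ)`, `m = dim M`, of `φ` with respect to the unit normal
field `ξ`. -/
def meanCurvature (φ : M → N) (ξ : Π x : M, TangentSpace 𝓘(ℝ, F) (φ x)) (x : M) : ℝ :=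
  (1 / (Module.finrank ℝ E : ℝ)) * inner ℝ (tension E F φ x) (ξ x)

end Maps

end RiemGeom

end

/-! Since `φ` is isometric, `B_φ` is normal. In codimension one this gives `τ(φ) = mH ξ`, where `mH`
is constant. The bitension field is therefore `mH (Δ̄ξ - ρ(ξ))`: the curvature term of `ξ` is the
full Ricci transform, because the only missing summand is `R(ξ, ξ)ξ = 0`. Everything reduces to the
two components of `Δ̄ξ`.

Normal component (`inner_roughLaplacian_normal`): differentiating `⟨∇̄ξ, ξ⟩ = 0` gives `⟨Δ̄ξ, ξ⟩ = ∑
‖∇̄_{e_i} ξ‖²`, which equals `‖B_φ‖²` by the Weingarten relation.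

Tangential component (`inner_roughLaplacian_mfderiv`): `⟨∇̄²ξ(u, v), dφ w⟩` is symmetric in `v, w`
because the shape operator is self-adjoint. Exchanging `u` and `v` costs a curvature term
(`secondCov_sub_secondCov`). Together these rewrite `∑ ⟨∇̄²ξ(e_i, e_i), dφ u⟩` as the `u`-derivative
of the trace of `∇̄ξ`, zero for constant mean curvature, plus `⟨ρ(ξ), dφ u⟩`. This is the traced
Codazzi equation.

Hence `Δ̄ξ - ρ(ξ)` has normal part `‖B_φ‖² - ⟨ρ(ξ), ξ⟩` and tangential part `-2⟨ρ(ξ), dφ u⟩`, so it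
vanishes exactly when `ρ(ξ) = ‖B_φ‖² ξ`. The Einstein case is a substitution. If Ricci is
non-positive and `H ≠ 0`, then `‖B_φ‖² = ⟨ρ(ξ), ξ⟩ ≤ 0`, so `B_φ = 0` and `τ(φ) = 0`; if `H = 0`,
then `τ(φ) = 0` already.

The remaining work is calculus. The connection along `φ` is given by a coordinate formula, so its
Leibniz rule, metric property and Ricci identity are proved for composites `W ∘ φ` and spread to all
fields by `along_induction`. Fields obtained by `extend` have constant chart coordinates; they
commute, which removes all brackets. -/

set_option linter.unusedSectionVars false

noncomputable section

namespace RiemGeom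

open VectorField FiberBundle

open Filter Topology

/-! ### Calculus in charts and coordinate vector fields. -/

section Calculus

variable {E : Type*} [NormedAddCommGroup E] [NormedSpace ℝ E] [FiniteDimensional ℝ E]
  {M : Type*} [TopologicalSpace M] [ChartedSpace E M] [IsManifold 𝓘(ℝ, E) ∞ M]

/-- The coordinates of a tangent vector at `y` in the preferred trivialization at `x₀`. -/
abbrev tangentCoord (x₀ y : M) (v : TangentSpace 𝓘(ℝ, E) y) : E :=
  (trivializationAt E (TangentSpace 𝓘(ℝ, E) : M → Type _) x₀ ⟨y, v⟩).2

lemma mem_baseSet_of_mem_chart {x₀ y : M} (hy : y ∈ (chartAt E x₀).source) :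
    y ∈ (trivializationAt E (TangentSpace 𝓘(ℝ, E) : M → Type _) x₀).baseSet := by
  simpa using hy

lemma eventually_mem_chart (x₀ : M) : ∀ᶠ y in 𝓝 x₀, y ∈ (chartAt E x₀).source :=
  (chartAt E x₀).open_source.mem_nhds (mem_chart_source E x₀)

lemma tangentCoord_add {x₀ y : M} (hy : y ∈ (chartAt E x₀).source)
    (v w : TangentSpace 𝓘(ℝ, E) y) :
    tangentCoord x₀ y (v + w) = tangentCoord x₀ y v + tangentCoord x₀ y w :=
  ((trivializationAt E (TangentSpace 𝓘(ℝ, E) : M → Type _) x₀).linear ℝ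
    (mem_baseSet_of_mem_chart hy)).map_add v w

lemma tangentCoord_smul {x₀ y : M} (hy : y ∈ (chartAt E x₀).source) (c : ℝ)
    (v : TangentSpace 𝓘(ℝ, E) y) :
    tangentCoord x₀ y (c • v) = c • tangentCoord x₀ y v :=
  ((trivializationAt E (TangentSpace 𝓘(ℝ, E) : M → Type _) x₀).linear ℝ
    (mem_baseSet_of_mem_chart hy)).map_smul c v

lemma tangentCoord_injective {x₀ y : M} (hy : y ∈ (chartAt E x₀).source) :
    Function.Injective (tangentCoord (E := E) x₀ y) :=
  ((trivializationAt E (TangentSpace 𝓘(ℝ, E) : M → Type _) x₀).linearEquivAt ℝ y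
    (mem_baseSet_of_mem_chart hy)).injective

lemma tangentCoord_extend {x₀ y : M} (hy : y ∈ (chartAt E x₀).source)
    (u : TangentSpace 𝓘(ℝ, E) x₀) :
    tangentCoord x₀ y (extend E u y) = tangentCoord x₀ x₀ u := by
  simp only [tangentCoord, extend]
  rw [Trivialization.apply_mk_symm _ (mem_baseSet_of_mem_chart hy)]

lemma extend_add {x₀ y : M} (hy : y ∈ (chartAt E x₀).source) (v w : TangentSpace 𝓘(ℝ, E) x₀) :
    extend E (v + w) y = extend E v y + extend E w y := by
  apply tangentCoord_injective hy
  rw [tangentCoord_add hy, tangentCoord_extend hy, tangentCoord_extend hy, tangentCoord_extend hy,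
    tangentCoord_add (mem_chart_source E x₀)]

lemma extend_smul {x₀ y : M} (hy : y ∈ (chartAt E x₀).source) (c : ℝ)
    (v : TangentSpace 𝓘(ℝ, E) x₀) :
    extend E (c • v) y = c • extend E v y := by
  apply tangentCoord_injective hy
  rw [tangentCoord_smul hy, tangentCoord_extend hy, tangentCoord_extend hy,
    tangentCoord_smul (mem_chart_source E x₀)]

/-- The coordinates of a tangent vector in the chart at `x₀` are given by the derivative of the
chart. -/
lemma mfderiv_extChartAt_apply {x₀ y : M} (hy : y ∈ (chartAt E x₀).source)
    (v : TangentSpace 𝓘(ℝ, E) y) :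
    mfderiv 𝓘(ℝ, E) 𝓘(ℝ, E) (extChartAt 𝓘(ℝ, E) x₀) y v = tangentCoord x₀ y v := by
  rw [← TangentBundle.continuousLinearMapAt_trivializationAt hy]
  exact Trivialization.continuousLinearMapAt_apply_of_mem ℝ _ (mem_baseSet_of_mem_chart hy) v

lemma tangentCoord_self (x₀ : M) (v : TangentSpace 𝓘(ℝ, E) x₀) :
    tangentCoord x₀ x₀ v = v := by
  rw [← mfderiv_extChartAt_apply (mem_chart_source E x₀), mfderiv_extChartAt_self]
  rfl

lemma contDiffAt_comp_chart_symm {A : Type*} [NormedAddCommGroup A] [NormedSpace ℝ A]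
    {f : M → A} {x₀ : M} {n : ℕ∞ω} (hf : CMDiffAt n f x₀) :
    ContDiffAt ℝ n (f ∘ (extChartAt 𝓘(ℝ, E) x₀).symm) (extChartAt 𝓘(ℝ, E) x₀ x₀) := by
  have h := (contMDiffAt_iff.1 hf).2
  rw [modelWithCornersSelf_coe, Set.range_id, contDiffWithinAt_univ] at h
  exact h

/-- Chain rule for `f = (f ∘ χ⁻¹) ∘ χ` with one chart `χ` fixed at `x₀` and `y` varying: it turns
derivatives along vector fields into Fréchet derivatives on a single vector space, where they can be
differentiated again. -/
lemma mvfderiv_eq_fderiv_chart {A : Type*} [NormedAddCommGroup A] [NormedSpace ℝ A]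
    {f : M → A} {x₀ y : M} (hy : y ∈ (chartAt E x₀).source)
    (hf : MDiffAt f y) (v : TangentSpace 𝓘(ℝ, E) y) :
    mvfderiv 𝓘(ℝ, E) f y v =
      fderiv ℝ (f ∘ (extChartAt 𝓘(ℝ, E) x₀).symm) (extChartAt 𝓘(ℝ, E) x₀ y)
        (tangentCoord x₀ y v) := by
  have hy' : y ∈ (extChartAt 𝓘(ℝ, E) x₀).source := by simpa using hy
  have hχ : MDiffAt (extChartAt 𝓘(ℝ, E) x₀) y := mdifferentiableAt_extChartAt hy
  have hleft : (extChartAt 𝓘(ℝ, E) x₀).symm (extChartAt 𝓘(ℝ, E) x₀ y) = y :=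
    (extChartAt 𝓘(ℝ, E) x₀).left_inv hy'
  have hsymm : MDiffAt (extChartAt 𝓘(ℝ, E) x₀).symm (extChartAt 𝓘(ℝ, E) x₀ y) :=
    ((contMDiffOn_extChartAt_symm (n := ∞) x₀).mdifferentiableOn (by simp)).mdifferentiableAt
      ((isOpen_extChartAt_target x₀).mem_nhds ((extChartAt 𝓘(ℝ, E) x₀).map_source hy'))
  have hg : MDiffAt (f ∘ (extChartAt 𝓘(ℝ, E) x₀).symm) (extChartAt 𝓘(ℝ, E) x₀ y) := by
    refine MDifferentiableAt.comp _ ?_ hsymm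
    rwa [hleft]
  have heq : f =ᶠ[𝓝 y] (f ∘ (extChartAt 𝓘(ℝ, E) x₀).symm) ∘ extChartAt 𝓘(ℝ, E) x₀ := by
    filter_upwards [(isOpen_extChartAt_source (I := 𝓘(ℝ, E)) x₀).mem_nhds hy'] with z hz
    simp only [Function.comp_apply]
    rw [(extChartAt 𝓘(ℝ, E) x₀).left_inv hz]
  have h1 : mfderiv 𝓘(ℝ, E) 𝓘(ℝ, A) f y =
      mfderiv 𝓘(ℝ, E) 𝓘(ℝ, A) ((f ∘ (extChartAt 𝓘(ℝ, E) x₀).symm) ∘ extChartAt 𝓘(ℝ, E) x₀) y :=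
    heq.mfderiv_eq
  have h2 := mfderiv_comp_apply y hg hχ v
  rw [mfderiv_extChartAt_apply hy, mfderiv_eq_fderiv] at h2
  have h3 := DFunLike.congr_fun h1 v
  exact h3.trans h2

lemma mdifferentiableAt_tangentCoord {x₀ : M} {Y : Π x : M, TangentSpace 𝓘(ℝ, E) x}
    (hY : MDiffAt (T% Y) x₀) : MDiffAt (fun y ↦ tangentCoord x₀ y (Y y)) x₀ :=
  (mdifferentiableAt_section _ Y).1 hY

lemma mvfderiv_congr {A : Type*} [NormedAddCommGroup A] [NormedSpace ℝ A]
    {f g : M → A} {x : M} (h : f =ᶠ[𝓝 x] g) :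
    mvfderiv 𝓘(ℝ, E) f x = mvfderiv 𝓘(ℝ, E) g x := by
  ext1 v
  exact DFunLike.congr_fun (h.mfderiv_eq (I := 𝓘(ℝ, E)) (I' := 𝓘(ℝ, A))) v

lemma eventually_mdifferentiableAt {A : Type*} [NormedAddCommGroup A] [NormedSpace ℝ A]
    {f : M → A} {x₀ : M} {n : ℕ∞ω} (hf : CMDiffAt n f x₀) (hn : 1 ≤ n) :
    ∀ᶠ y in 𝓝 x₀, MDiffAt f y := by
  filter_upwards [(contMDiffAt_iff_contMDiffAt_nhds (by simp)).1 (hf.of_le hn)] with y hy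
  exact hy.mdifferentiableAt one_ne_zero

/-- The derivative of a `C²` function along a differentiable vector field is differentiable. -/
lemma mdifferentiableAt_mvfderiv_apply {f : M → ℝ} {x₀ : M} (hf : CMDiffAt 2 f x₀)
    {Y : Π x : M, TangentSpace 𝓘(ℝ, E) x} (hY : MDiffAt (T% Y) x₀) :
    MDiffAt (fun y ↦ mvfderiv 𝓘(ℝ, E) f y (Y y)) x₀ := by
  have h1 := contDiffAt_comp_chart_symm hf
  have h2 : DifferentiableAt ℝ (fderiv ℝ (f ∘ (extChartAt 𝓘(ℝ, E) x₀).symm))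
      (extChartAt 𝓘(ℝ, E) x₀ x₀) :=
    (h1.fderiv_right (m := 1) (by norm_num)).differentiableAt one_ne_zero
  have h3 : MDiffAt (fun y ↦ fderiv ℝ (f ∘ (extChartAt 𝓘(ℝ, E) x₀).symm)
      (extChartAt 𝓘(ℝ, E) x₀ y)) x₀ :=
    MDifferentiableAt.comp x₀ h2.mdifferentiableAt
      (mdifferentiableAt_extChartAt (mem_chart_source E x₀))
  refine (h3.clm_apply (mdifferentiableAt_tangentCoord hY)).congr_of_eventuallyEq ?_
  filter_upwards [eventually_mem_chart (E := E) x₀, eventually_mdifferentiableAt hf (by norm_num)]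
    with y hy hfy
  exact mvfderiv_eq_fderiv_chart hy hfy _

/-- The coordinates of `extend E v` are constant on the chart domain, so no first-order term appears
and only the second Fréchet derivative of the chart expression survives. -/
lemma mvfderiv_mvfderiv_extend {f : M → ℝ} {x₀ : M} (hf : CMDiffAt 2 f x₀)
    (u v : TangentSpace 𝓘(ℝ, E) x₀) :
    mvfderiv 𝓘(ℝ, E) (fun y ↦ mvfderiv 𝓘(ℝ, E) f y (extend E v y)) x₀ u =
      fderiv ℝ (fderiv ℝ (f ∘ (extChartAt 𝓘(ℝ, E) x₀).symm)) (extChartAt 𝓘(ℝ, E) x₀ x₀)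
        (tangentCoord x₀ x₀ u) (tangentCoord x₀ x₀ v) := by
  have h2 : DifferentiableAt ℝ (fderiv ℝ (f ∘ (extChartAt 𝓘(ℝ, E) x₀).symm))
      (extChartAt 𝓘(ℝ, E) x₀ x₀) :=
    ((contDiffAt_comp_chart_symm hf).fderiv_right (m := 1) (by norm_num)).differentiableAt
      one_ne_zero
  rw [mvfderiv_eq_fderiv_chart (mem_chart_source E x₀) (mdifferentiableAt_mvfderiv_apply hf
    (mdifferentiableAt_extend 𝓘(ℝ, E) E v))]
  have heq : ((fun y ↦ mvfderiv 𝓘(ℝ, E) f y (extend E v y)) ∘ (extChartAt 𝓘(ℝ, E) x₀).symm)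
      =ᶠ[𝓝 (extChartAt 𝓘(ℝ, E) x₀ x₀)]
      fun z ↦ fderiv ℝ (f ∘ (extChartAt 𝓘(ℝ, E) x₀).symm) z (tangentCoord x₀ x₀ v) := by
    have hc : Tendsto (extChartAt 𝓘(ℝ, E) x₀).symm (𝓝 (extChartAt 𝓘(ℝ, E) x₀ x₀)) (𝓝 x₀) := by
      have h := continuousAt_extChartAt_symm (I := 𝓘(ℝ, E)) x₀
      rwa [ContinuousAt, extChartAt_to_inv] at h
    filter_upwards [hc.eventually (eventually_mem_chart (E := E) x₀),
      hc.eventually (eventually_mdifferentiableAt hf (by norm_num)),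
      extChartAt_target_mem_nhds (I := 𝓘(ℝ, E)) x₀] with z hz hfz hzt
    simp only [Function.comp_apply]
    rw [mvfderiv_eq_fderiv_chart hz hfz, tangentCoord_extend hz,
      (extChartAt 𝓘(ℝ, E) x₀).right_inv hzt]
  rw [heq.fderiv_eq, fderiv_clm_apply h2 (differentiableAt_const _)]
  simp

/-- Coordinate vector fields commute as derivations. -/
lemma mvfderiv_mvfderiv_extend_comm {f : M → ℝ} {x₀ : M} (hf : CMDiffAt 2 f x₀)
    (u v : TangentSpace 𝓘(ℝ, E) x₀) :
    mvfderiv 𝓘(ℝ, E) (fun y ↦ mvfderiv 𝓘(ℝ, E) f y (extend E v y)) x₀ u =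
      mvfderiv 𝓘(ℝ, E) (fun y ↦ mvfderiv 𝓘(ℝ, E) f y (extend E u y)) x₀ v := by
  rw [mvfderiv_mvfderiv_extend hf, mvfderiv_mvfderiv_extend hf]
  exact ((contDiffAt_comp_chart_symm hf).isSymmSndFDerivAt (by simp)).eq _ _

/-- Coordinate vector fields commute. -/
lemma mlieBracket_extend {x₀ y : M} (hy : y ∈ (chartAt E x₀).source)
    (u v : TangentSpace 𝓘(ℝ, E) x₀) :
    mlieBracket 𝓘(ℝ, E) (extend E u) (extend E v) y = 0 := by
  have : IsManifold 𝓘(ℝ, E) (minSmoothness ℝ 2) M := by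
    rw [minSmoothness_of_isRCLikeNormedField]
    infer_instance
  -- `extend` fields are chart pullbacks of constant fields on the model space; brackets are natural
  -- under pullback, and constant fields have zero bracket.
  let K (e : E) : Π z : E, TangentSpace 𝓘(ℝ, E) z := fun _ ↦ e
  have hK (e z : E) : MDiffAt (T% (K e)) z :=
    (contMDiffAt_vectorSpace_iff_contDiffAt.2
      (contDiffAt_const (n := 1) (c := e))).mdifferentiableAt one_ne_zero
  have key (w : TangentSpace 𝓘(ℝ, E) x₀) : (extend E w : Π z : M, TangentSpace 𝓘(ℝ, E) z) =ᶠ[𝓝 y]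
      mpullback 𝓘(ℝ, E) 𝓘(ℝ, E) (extChartAt 𝓘(ℝ, E) x₀) (K (tangentCoord x₀ x₀ w)) := by
    filter_upwards [(chartAt E x₀).open_source.mem_nhds hy] with z hz
    have hz' : z ∈ (extChartAt 𝓘(ℝ, E) x₀).source := by simpa using hz
    have hinv := isInvertible_mfderiv_extChartAt (I := 𝓘(ℝ, E)) hz'
    refine (hinv.inverse_apply_eq.2 ?_).symm
    exact ((mfderiv_extChartAt_apply hz _).trans (tangentCoord_extend hz w)).symm
  rw [(key u).mlieBracket_vectorField_eq (key v), ← mpullback_mlieBracket (n := ∞)]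
  · rw [mpullback_apply, ← mlieBracketWithin_univ, mlieBracketWithin_eq_lieBracketWithin]
    have h0 (a b z : E) : lieBracketWithin ℝ (K a) (K b) Set.univ z = 0 := by
      simp [lieBracketWithin, K]
    rw [h0]
    exact ContinuousLinearMap.map_zero _
  · exact hK _ _
  · exact hK _ _
  · exact contMDiffAt_extChartAt' hy
  · rw [minSmoothness_of_isRCLikeNormedField]
    exact WithTop.coe_le_coe.2 le_top

end Calculus

/-! ### Orthonormal bases and traces. -/

section OrthonormalFamilies

variable {V : Type*} [NormedAddCommGroup V] [InnerProductSpace ℝ V] [FiniteDimensional ℝ V]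
  {ι : Type*} [Fintype ι]

/-- An orthonormal family of the right cardinality, as an orthonormal basis. -/
def orthonormalBasisOfCard {v : ι → V} (hv : Orthonormal ℝ v)
    (hcard : Fintype.card ι = Module.finrank ℝ V) : OrthonormalBasis ι ℝ V :=
  OrthonormalBasis.mk hv
    (hv.linearIndependent.span_eq_top_of_card_eq_finrank' hcard).ge

@[simp]
lemma coe_orthonormalBasisOfCard {v : ι → V} (hv : Orthonormal ℝ v)
    (hcard : Fintype.card ι = Module.finrank ℝ V) : ⇑(orthonormalBasisOfCard hv hcard) = v :=
  OrthonormalBasis.coe_mk _ _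

/-- The trace of a bilinear form does not depend on the orthonormal basis. -/
lemma sum_bilin_orthonormalBasis_eq {ι' : Type*} [Fintype ι'] (β : V →ₗ[ℝ] V →ₗ[ℝ] ℝ)
    (b : OrthonormalBasis ι ℝ V) (b' : OrthonormalBasis ι' ℝ V) :
    ∑ i, β (b i) (b i) = ∑ i, β (b' i) (b' i) := by
  have h (i : ι) : β (b i) (b i) = ∑ j, ∑ k, inner ℝ (b' j) (b i) * inner ℝ (b i) (b' k) *
      β (b' j) (b' k) := by
    conv_lhs => rw [← b'.sum_repr' (b i)]
    simp only [map_sum, map_smul, LinearMap.sum_apply, LinearMap.smul_apply, smul_eq_mul,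
      Finset.mul_sum]
    rw [Finset.sum_comm]
    refine Finset.sum_congr rfl fun j _ ↦ Finset.sum_congr rfl fun k _ ↦ ?_
    rw [real_inner_comm (b' k)]
    ring
  simp only [h]
  rw [Finset.sum_comm]
  refine Finset.sum_congr rfl fun j _ ↦ ?_
  rw [Finset.sum_comm, Finset.sum_eq_single j]
  · rw [← Finset.sum_mul, b.sum_inner_mul_inner]
    simp
  · intro k _ hk
    rw [← Finset.sum_mul, b.sum_inner_mul_inner, b'.inner_eq_zero (Ne.symm hk), zero_mul]
  · simp

end OrthonormalFamilies

/-! ### Rules and regularity for the Levi-Civita connection. -/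

section LeviCivitaCalculus

variable {E : Type*} [NormedAddCommGroup E] [NormedSpace ℝ E] [FiniteDimensional ℝ E]
  {M : Type*} [TopologicalSpace M] [ChartedSpace E M] [IsManifold 𝓘(ℝ, E) ∞ M]
  [RiemannianBundle (fun x : M ↦ TangentSpace 𝓘(ℝ, E) x)]
  [IsContMDiffRiemannianBundle 𝓘(ℝ, E) ∞ E (fun x : M ↦ TangentSpace 𝓘(ℝ, E) x)]
  {X Y Z W : Π x : M, TangentSpace 𝓘(ℝ, E) x} {x : M}

lemma leviCivita_congr (hX : MDiffAt (T% X) x) (hY : MDiffAt (T% Y) x) (h : X =ᶠ[𝓝 x] Y) :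
    leviCivita M X x = leviCivita M Y x :=
  (leviCivita M).isCovariantDerivativeOnUniv.congr_of_eventuallyEq hX hY univ_mem h

lemma leviCivita_add (hX : MDiffAt (T% X) x) (hY : MDiffAt (T% Y) x) :
    leviCivita M (X + Y) x = leviCivita M X x + leviCivita M Y x :=
  (leviCivita M).isCovariantDerivativeOnUniv.add hX hY

lemma leviCivita_smul {f : M → ℝ} (hf : MDiffAt f x) (hX : MDiffAt (T% X) x) :
    leviCivita M (f • X) x =
      f x • leviCivita M X x + (mvfderiv 𝓘(ℝ, E) f x).smulRight (X x) :=
  (leviCivita M).isCovariantDerivativeOnUniv.leibniz hX hf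

lemma leviCivita_sum {ι : Type*} (s : Finset ι) {f : ι → M → ℝ}
    {X : ι → Π x : M, TangentSpace 𝓘(ℝ, E) x} (hf : ∀ i ∈ s, MDiffAt (f i) x)
    (hX : ∀ i ∈ s, MDiffAt (T% (X i)) x) :
    leviCivita M (fun y ↦ ∑ i ∈ s, f i y • X i y) x =
      ∑ i ∈ s, (f i x • leviCivita M (X i) x + (mvfderiv 𝓘(ℝ, E) (f i) x).smulRight (X i x)) := by
  classical
  induction s using Finset.induction_on with
  | empty =>
    simp only [Finset.sum_empty]
    exact congrFun (CovariantDerivative.zero (leviCivita M)) x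
  | insert a s ha ih =>
    simp only [Finset.mem_insert, forall_eq_or_imp] at hf hX
    simp only [Finset.sum_insert ha]
    rw [← ih hf.2 hX.2, ← leviCivita_smul hf.1 hX.1, ← leviCivita_add]
    · rfl
    · exact hf.1.smul_section hX.1
    · exact MDifferentiableAt.sum_section fun i hi ↦ (hf.2 i hi).smul_section (hX.2 i hi)

lemma mvfderiv_inner (hX : MDiffAt (T% X) x) (hY : MDiffAt (T% Y) x)
    (v : TangentSpace 𝓘(ℝ, E) x) :
    mvfderiv 𝓘(ℝ, E) (fun y ↦ (inner ℝ (X y) (Y y) : ℝ)) x v =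
      inner ℝ (leviCivita M X x v) (Y x) + inner ℝ (X x) (leviCivita M Y x v) := by
  have h := (leviCivita_isMetricCompatible (E := E) (M := M)).mvfderiv_inner_eq
    (extend E v) hX hY
  simpa using h

lemma leviCivita_sub_eq_mlieBracket (hX : MDiffAt (T% X) x) (hY : MDiffAt (T% Y) x) :
    leviCivita M Y x (X x) - leviCivita M X x (Y x) = mlieBracket 𝓘(ℝ, E) X Y x :=
  (CovariantDerivative.torsion_eq_zero_iff _).1 leviCivita_torsion hX hY

/-- `leviCivita` is a chosen witness of an existence statement, so the Koszul formula is recovered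
from metric compatibility and vanishing torsion alone. It presents the components of `∇_X Y` as
expressions whose regularity can be read off. -/
lemma inner_leviCivita_eq_koszul (hX : MDiffAt (T% X) x) (hY : MDiffAt (T% Y) x)
    (hZ : MDiffAt (T% Z) x) :
    inner ℝ (leviCivita M Y x (X x)) (Z x) = koszul X Y Z x := by
  simp only [koszul]
  rw [mvfderiv_inner hY hZ, mvfderiv_inner hX hZ, mvfderiv_inner hX hY,
    ← leviCivita_sub_eq_mlieBracket hX hY, ← leviCivita_sub_eq_mlieBracket hX hZ,
    ← leviCivita_sub_eq_mlieBracket hY hZ]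
  simp only [inner_sub_left]
  rw [real_inner_comm (leviCivita M Z x (X x)), real_inner_comm (leviCivita M Z x (Y x)),
    real_inner_comm (leviCivita M Y x (Z x))]
  ring

lemma contMDiffAt_mdiff (hX : CMDiffAt 2 (T% X) x) : ∀ᶠ y in 𝓝 x, MDiffAt (T% X) y := by
  filter_upwards [(contMDiffAt_iff_contMDiffAt_nhds (by simp)).1 hX] with y hy
  exact hy.mdifferentiableAt (by simp)

lemma contMDiffAt_inner {n : ℕ∞ω} [IsContMDiffRiemannianBundle 𝓘(ℝ, E) n E
      (fun x : M ↦ TangentSpace 𝓘(ℝ, E) x)] (hX : CMDiffAt n (T% X) x) (hY : CMDiffAt n (T% Y) x) :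
    CMDiffAt n (fun y ↦ (inner ℝ (X y) (Y y) : ℝ)) x :=
  ContMDiffAt.inner_bundle (IB := 𝓘(ℝ, E)) (F := E)
    (E := fun x : M ↦ TangentSpace 𝓘(ℝ, E) x) hX hY

lemma mdifferentiableAt_koszul (hX : CMDiffAt 2 (T% X) x) (hY : CMDiffAt 2 (T% Y) x)
    (hZ : CMDiffAt 2 (T% Z) x) : MDiffAt (koszul X Y Z) x := by
  have hd {A B C : Π x : M, TangentSpace 𝓘(ℝ, E) x} (hA : CMDiffAt 2 (T% A) x)
      (hB : CMDiffAt 2 (T% B) x) (hC : CMDiffAt 2 (T% C) x) :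
      MDiffAt (fun y ↦ mvfderiv 𝓘(ℝ, E) (fun y ↦ (inner ℝ (A y) (B y) : ℝ)) y (C y)) x :=
    mdifferentiableAt_mvfderiv_apply (contMDiffAt_inner hA hB) (hC.mdifferentiableAt (by simp))
  have hb {A B C : Π x : M, TangentSpace 𝓘(ℝ, E) x} (hA : CMDiffAt 2 (T% A) x)
      (hB : CMDiffAt 2 (T% B) x) (hC : CMDiffAt 2 (T% C) x) :
      MDiffAt (fun y ↦ (inner ℝ (mlieBracket 𝓘(ℝ, E) A B y) (C y) : ℝ)) x := by
    have : IsManifold 𝓘(ℝ, E) (((2 : ℕ∞) : ℕ∞ω) + 1) M := IsManifold.of_le (n := ∞) (by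
      exact WithTop.coe_le_coe.2 le_top)
    have : IsManifold 𝓘(ℝ, E) (minSmoothness ℝ 2) M := by
      rw [minSmoothness_of_isRCLikeNormedField]
      infer_instance
    have h := ContMDiffAt.mlieBracket_vectorField (m := 1) (n := 2) hA hB
      (by rw [minSmoothness_of_isRCLikeNormedField]; norm_num)
    exact inner_mdiff (h.mdifferentiableAt (by simp)) (hC.mdifferentiableAt (by simp))
  unfold koszul
  exact mdifferentiableAt_const.mul ((((((hd hY hZ hX).add (hd hX hZ hY)).sub (hd hX hY hZ)).add
    (hb hX hY hZ)).sub (hb hX hZ hY)).sub (hb hY hZ hX))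

/-- Near every point there is a smooth orthonormal frame. -/
lemma exists_orthonormal_frame (x : M) :
    ∃ s : Fin (Module.finrank ℝ E) → Π y : M, TangentSpace 𝓘(ℝ, E) y,
      (∀ i, CMDiffAt ∞ (T% (s i)) x) ∧ ∀ᶠ y in 𝓝 x, Orthonormal ℝ (fun i ↦ s i y) := by
  set e := trivializationAt E (TangentSpace 𝓘(ℝ, E) : M → Type _) x
  have hx : x ∈ e.baseSet := mem_baseSet_trivializationAt' x
  let f := e.localFrame (Module.finBasis ℝ E)
  have hf (i) : CMDiffAt ∞ (T% (f i)) x := contMDiffAt_localFrame_of_mem ∞ e _ i hx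
  have hli {y : M} (hy : y ∈ e.baseSet) : LinearIndependent ℝ (fun i ↦ f i y) :=
    (e.isLocalFrameOn_localFrame_baseSet 𝓘(ℝ, E) ∞ (Module.finBasis ℝ E)).linearIndependent hy
  let g (i : Fin (Module.finrank ℝ E)) (y : M) : TangentSpace 𝓘(ℝ, E) y :=
    InnerProductSpace.gramSchmidt ℝ (fun i ↦ f i y) i
  have hg0 (i) : (inner ℝ (g i x) (g i x) : ℝ) ≠ 0 :=
    inner_self_ne_zero.2 (InnerProductSpace.gramSchmidt_ne_zero i (hli hx))
  -- Smoothness passes through Gram-Schmidt by strong induction: each vector is a frame vector minus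
  -- combinations of earlier ones, with coefficients whose denominators do not vanish at `x`.
  have hg (i) : CMDiffAt ∞ (T% (g i)) x := by
    induction i using WellFoundedLT.induction with
    | ind i ih =>
      have heq : g i = f i - fun y ↦ ∑ j ∈ Finset.Iio i,
          ((inner ℝ (g j y) (f i y) : ℝ) / (inner ℝ (g j y) (g j y) : ℝ)) • g j y := by
        ext1 y
        have h := InnerProductSpace.gramSchmidt_def'' ℝ (fun i ↦ f i y) i
        simp only [Pi.sub_apply]
        rw [eq_sub_iff_add_eq]
        refine Eq.trans ?_ h.symm
        simp only [g, real_inner_self_eq_norm_sq]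
        rfl
      rw [heq]
      refine (hf i).sub_section (ContMDiffAt.sum_section fun j hj ↦ ?_)
      have hj' := ih j (Finset.mem_Iio.1 hj)
      exact ((contMDiffAt_inner hj' (hf i)).div₀ (contMDiffAt_inner hj' hj')
        (hg0 j)).smul_section hj'
  refine ⟨fun i y ↦ InnerProductSpace.gramSchmidtNormed ℝ (fun i ↦ f i y) i, fun i ↦ ?_, ?_⟩
  -- The norm is written as the square root of the inner product, which is smooth because the
  -- radicand is nonzero at `x`.
  · have h1 : CMDiffAt ∞ (fun y ↦ (√(inner ℝ (g i y) (g i y) : ℝ))⁻¹) x :=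
      (ContDiffAt.comp_contMDiffAt (f := fun y ↦ (inner ℝ (g i y) (g i y) : ℝ)) (x := x)
        (Real.contDiffAt_sqrt (hg0 i)) (contMDiffAt_inner (hg i) (hg i))).inv₀ (Real.sqrt_ne_zero'.2 (lt_of_le_of_ne real_inner_self_nonneg (hg0 i).symm))
    refine (h1.smul_section (hg i)).congr_of_eventuallyEq (Eventually.of_forall fun y ↦ ?_)
    simp only [InnerProductSpace.gramSchmidtNormed, g, real_inner_self_eq_norm_sq,
      Real.sqrt_sq (norm_nonneg _)]
    rfl
  · filter_upwards [e.open_baseSet.mem_nhds hx] with y hy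
    exact InnerProductSpace.gramSchmidtNormed_orthonormal (hli hy)

/-- If `X` and `W` are `C²` at `x`, then `∇_X W` is differentiable at `x`. -/
lemma mdifferentiableAt_leviCivita (hX : CMDiffAt 2 (T% X) x) (hW : CMDiffAt 2 (T% W) x) :
    MDiffAt (T% (fun y ↦ leviCivita M W y (X y))) x := by
  obtain ⟨s, hs, hon⟩ := exists_orthonormal_frame (E := E) x
  have hs2 (i) : CMDiffAt 2 (T% (s i)) x := (hs i).of_le (WithTop.coe_le_coe.2 le_top)
  -- In an orthonormal frame the components of `∇_X W` are Koszul expressions, which are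
  -- differentiable.
  have h1 : MDiffAt (T% (fun y ↦ ∑ i, koszul X W (s i) y • s i y)) x :=
    MDifferentiableAt.sum_section fun i _ ↦ (mdifferentiableAt_koszul hX hW (hs2 i)).smul_section
      ((hs2 i).mdifferentiableAt (by simp))
  refine h1.congr_of_eventuallyEq ?_
  filter_upwards [hon, contMDiffAt_mdiff hX, contMDiffAt_mdiff hW,
    eventually_all.2 fun i ↦ contMDiffAt_mdiff (hs2 i)] with y hy hXy hWy hsy
  congr 1
  have hcard : Fintype.card (Fin (Module.finrank ℝ E)) =
    Module.finrank ℝ (TangentSpace 𝓘(ℝ, E) y) := Fintype.card_fin _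
  rw [← (orthonormalBasisOfCard hy hcard).sum_repr' (leviCivita M W y (X y))]
  refine Finset.sum_congr rfl fun i _ ↦ ?_
  rw [coe_orthonormalBasisOfCard, real_inner_comm, inner_leviCivita_eq_koszul hXy hWy (hsy i)]

end LeviCivitaCalculus

/-! ### Symmetries of the curvature tensor and the Ricci transform. -/

section Curvature

variable {E : Type*} [NormedAddCommGroup E] [NormedSpace ℝ E] [FiniteDimensional ℝ E]
  {M : Type*} [TopologicalSpace M] [ChartedSpace E M] [IsManifold 𝓘(ℝ, E) ∞ M]
  [RiemannianBundle (fun x : M ↦ TangentSpace 𝓘(ℝ, E) x)]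
  [IsContMDiffRiemannianBundle 𝓘(ℝ, E) ∞ E (fun x : M ↦ TangentSpace 𝓘(ℝ, E) x)]
  {x : M}

lemma mdifferentiableAt_leviCivita_extend (v w : TangentSpace 𝓘(ℝ, E) x) :
    MDiffAt (T% (fun y ↦ leviCivita M (extend E w) y (extend E v y))) x :=
  mdifferentiableAt_leviCivita (contMDiffAt_extend 𝓘(ℝ, E) E v) (contMDiffAt_extend 𝓘(ℝ, E) E w)

lemma eventually_mdiff_extend (v : TangentSpace 𝓘(ℝ, E) x) :
    ∀ᶠ y in 𝓝 x, MDiffAt (T% (extend E v)) y :=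
  contMDiffAt_mdiff (contMDiffAt_extend 𝓘(ℝ, E) E v)

lemma curvature_eq (u v w : TangentSpace 𝓘(ℝ, E) x) :
    curvature x u v w =
      leviCivita M (fun y ↦ leviCivita M (extend E w) y (extend E v y)) x u
        - leviCivita M (fun y ↦ leviCivita M (extend E w) y (extend E u y)) x v := by
  rw [curvature, mlieBracket_extend (mem_chart_source E x), map_zero, sub_zero]

lemma curvature_antisymm (u v w : TangentSpace 𝓘(ℝ, E) x) :
    curvature x u v w = -curvature x v u w := by
  rw [curvature_eq, curvature_eq, neg_sub]

lemma leviCivita_const_smul (c : ℝ) {X : Π x : M, TangentSpace 𝓘(ℝ, E) x}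
    (hX : MDiffAt (T% X) x) : leviCivita M (c • X) x = c • leviCivita M X x :=
  (leviCivita M).isCovariantDerivativeOnUniv.smul_const c hX

lemma curvature_add_left (u u' v w : TangentSpace 𝓘(ℝ, E) x) :
    curvature x (u + u') v w = curvature x u v w + curvature x u' v w := by
  have h : leviCivita M (fun y ↦ leviCivita M (extend E w) y (extend E (u + u') y)) x =
      leviCivita M ((fun y ↦ leviCivita M (extend E w) y (extend E u y)) +
        (fun y ↦ leviCivita M (extend E w) y (extend E u' y))) x := by
    refine leviCivita_congr (mdifferentiableAt_leviCivita_extend _ _)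
      (mdifferentiableAt_add_section (mdifferentiableAt_leviCivita_extend _ _)
        (mdifferentiableAt_leviCivita_extend _ _)) ?_
    filter_upwards [eventually_mem_chart (E := E) x] with y hy
    simp only [Pi.add_apply]
    rw [extend_add hy, map_add]
  rw [curvature_eq, curvature_eq, curvature_eq, h,
    leviCivita_add (mdifferentiableAt_leviCivita_extend _ _)
      (mdifferentiableAt_leviCivita_extend _ _), map_add, add_apply]
  abel

lemma curvature_smul_left (c : ℝ) (u v w : TangentSpace 𝓘(ℝ, E) x) :
    curvature x (c • u) v w = c • curvature x u v w := by
  have h : leviCivita M (fun y ↦ leviCivita M (extend E w) y (extend E (c • u) y)) x =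
      leviCivita M (c • (fun y ↦ leviCivita M (extend E w) y (extend E u y))) x := by
    refine leviCivita_congr (mdifferentiableAt_leviCivita_extend _ _)
      (mdifferentiableAt_const.smul_section (mdifferentiableAt_leviCivita_extend _ _)) ?_
    filter_upwards [eventually_mem_chart (E := E) x] with y hy
    simp only [Pi.smul_apply]
    rw [extend_smul hy, map_smul]
  rw [curvature_eq, curvature_eq, h,
    leviCivita_const_smul c (mdifferentiableAt_leviCivita_extend _ _), map_smul,
    smul_apply, smul_sub]

/-- The curvature operator is skew-symmetric. -/
lemma inner_curvature_swap (u v w z : TangentSpace 𝓘(ℝ, E) x) :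
    (inner ℝ (curvature x u v w) z : ℝ) = -inner ℝ (curvature x u v z) w := by
  have hW := mdifferentiableAt_extend 𝓘(ℝ, E) E w
  have hZ := mdifferentiableAt_extend 𝓘(ℝ, E) E z
  -- Differentiating `⟨W, Z⟩` twice produces the wanted second derivatives plus cross terms
  -- symmetric in `u, v`. The left side is also symmetric, so antisymmetrizing leaves only
  -- curvature.
  have key (u v : TangentSpace 𝓘(ℝ, E) x) :
      mvfderiv 𝓘(ℝ, E) (fun y ↦ mvfderiv 𝓘(ℝ, E)
        (fun y ↦ (inner ℝ (extend E w y) (extend E z y) : ℝ)) y (extend E v y)) x u =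
      inner ℝ (leviCivita M (fun y ↦ leviCivita M (extend E w) y (extend E v y)) x u) z +
      inner ℝ (leviCivita M (extend E w) x v) (leviCivita M (extend E z) x u) +
      (inner ℝ (leviCivita M (extend E w) x u) (leviCivita M (extend E z) x v) +
      inner ℝ w (leviCivita M (fun y ↦ leviCivita M (extend E z) y (extend E v y)) x u)) := by
    have heq : (fun y ↦ mvfderiv 𝓘(ℝ, E)
        (fun y ↦ (inner ℝ (extend E w y) (extend E z y) : ℝ)) y (extend E v y)) =ᶠ[𝓝 x]
        ((fun y ↦ (inner ℝ (leviCivita M (extend E w) y (extend E v y)) (extend E z y) : ℝ)) +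
        fun y ↦ (inner ℝ (extend E w y) (leviCivita M (extend E z) y (extend E v y)) : ℝ)) := by
      filter_upwards [eventually_mdiff_extend w, eventually_mdiff_extend z] with y hw hz
      exact mvfderiv_inner hw hz _
    rw [mvfderiv_congr heq, mvfderiv_add (inner_mdiff (mdifferentiableAt_leviCivita_extend v w) hZ)
      (inner_mdiff hW (mdifferentiableAt_leviCivita_extend v z)), add_apply,
      mvfderiv_inner (mdifferentiableAt_leviCivita_extend v w) hZ,
      mvfderiv_inner hW (mdifferentiableAt_leviCivita_extend v z)]
    simp only [extend_apply_self]
  have hsymm := mvfderiv_mvfderiv_extend_comm (x₀ := x)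
    (contMDiffAt_inner (n := 2) (contMDiffAt_extend 𝓘(ℝ, E) E w)
      (contMDiffAt_extend 𝓘(ℝ, E) E z)) u v
  rw [key, key] at hsymm
  rw [curvature_eq, curvature_eq, inner_sub_left, inner_sub_left,
    real_inner_comm w, real_inner_comm w]
  linarith

/-- The first Bianchi identity. -/
lemma curvature_bianchi (u v w : TangentSpace 𝓘(ℝ, E) x) :
    curvature x u v w + curvature x v w u + curvature x w u v = 0 := by
  -- Torsion-freeness and commuting extensions give `∇_V W = ∇_W V` near `x`; the six terms of the
  -- cyclic sum then cancel in pairs.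
  have key (u v w : TangentSpace 𝓘(ℝ, E) x) :
      leviCivita M (fun y ↦ leviCivita M (extend E w) y (extend E v y)) x u =
      leviCivita M (fun y ↦ leviCivita M (extend E v) y (extend E w y)) x u := by
    refine DFunLike.congr_fun (leviCivita_congr (mdifferentiableAt_leviCivita_extend _ _)
      (mdifferentiableAt_leviCivita_extend _ _) ?_) u
    filter_upwards [eventually_mdiff_extend w, eventually_mdiff_extend v,
      eventually_mem_chart (E := E) x] with y hw hv hy
    exact sub_eq_zero.1 ((leviCivita_sub_eq_mlieBracket hv hw).trans (mlieBracket_extend hy v w))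
  rw [curvature_eq, curvature_eq, curvature_eq, key u v w, key v w u, key w u v]
  abel

/-- The pair symmetry of the curvature tensor. -/
lemma inner_curvature_pair_symm (u v w z : TangentSpace 𝓘(ℝ, E) x) :
    (inner ℝ (curvature x u v w) z : ℝ) = inner ℝ (curvature x w z u) v := by
  have A (a b c d : TangentSpace 𝓘(ℝ, E) x) :
      (inner ℝ (curvature x a b c) d : ℝ) = -inner ℝ (curvature x b a c) d := by
    rw [curvature_antisymm, inner_neg_left]
  have B (a b c d : TangentSpace 𝓘(ℝ, E) x) := congrArg (fun t ↦ (inner ℝ t d : ℝ))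
    (curvature_bianchi a b c)
  simp only [inner_add_left, inner_zero_left] at B
  have S := inner_curvature_swap (E := E) (x := x)
  -- The octahedron argument: the four Bianchi identities, each omitting one of the four vectors and
  -- pairing with it, are combined using the two skew-symmetries `A` and `S`.
  linarith [B u v w z, B v w z u, B w z u v, B z u v w, S u v w z, S v w u z, S w u v z,
    S w z u v, S z u v w, S u v z w, S z u w v, S v z w u, A v z w u, A z v w u, S w z v u,
    A u w z v, A w u z v, A u z v w, A z u v w, A v w z u, S u w z v, A w u v z, A u z w v,
    A v w u z, A z u w v, A v z u w, A z v u w, S v z u w]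

lemma curvature_self (u w : TangentSpace 𝓘(ℝ, E) x) : curvature x u u w = 0 := by
  rw [curvature_eq, sub_self]

/-- The bilinear form `(v, w) ↦ ⟨R(u, v)w, z⟩`. -/
def curvatureForm (u z : TangentSpace 𝓘(ℝ, E) x) :
    TangentSpace 𝓘(ℝ, E) x →ₗ[ℝ] TangentSpace 𝓘(ℝ, E) x →ₗ[ℝ] ℝ :=
  LinearMap.mk₂ ℝ (fun v w ↦ (inner ℝ (curvature x u v w) z : ℝ))
    -- Only linearity in the first slot was proved directly; antisymmetry carries it to `v`, and
    -- skew-symmetry of the curvature operator reduces linearity in `w` to that of the inner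
    -- product.
    (fun v v' w ↦ by
      rw [curvature_antisymm, curvature_add_left, curvature_antisymm u v, curvature_antisymm u v',
        neg_add, inner_add_left])
    (fun c v w ↦ by
      rw [curvature_antisymm, curvature_smul_left, curvature_antisymm u v, ← smul_neg,
        real_inner_smul_left, smul_eq_mul])
    (fun v w w' ↦ by
      rw [inner_curvature_swap, inner_curvature_swap _ _ w, inner_curvature_swap _ _ w',
        inner_add_right, neg_add])
    (fun c v w ↦ by
      rw [inner_curvature_swap, inner_curvature_swap _ _ w, real_inner_smul_right, smul_eq_mul,
        mul_neg])

/-- Frees the Ricci transform from the standard basis of its definition, so that it can be evaluated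
in a basis adapted to the hypersurface. -/
lemma inner_ricciTransform {ι : Type*} [Fintype ι] (u z : TangentSpace 𝓘(ℝ, E) x)
    (b : OrthonormalBasis ι ℝ (TangentSpace 𝓘(ℝ, E) x)) :
    (inner ℝ (ricciTransform x u) z : ℝ) = ∑ i, inner ℝ (curvature x u (b i) (b i)) z := by
  rw [ricciTransform, sum_inner]
  exact sum_bilin_orthonormalBasis_eq (curvatureForm u z) _ b

end Curvature

/-! ### Vector fields along a map. -/

section Along

variable {E : Type*} [NormedAddCommGroup E] [NormedSpace ℝ E] [FiniteDimensional ℝ E]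
  {M : Type*} [TopologicalSpace M] [ChartedSpace E M] [IsManifold 𝓘(ℝ, E) ∞ M]
  {F : Type*} [NormedAddCommGroup F] [NormedSpace ℝ F] [FiniteDimensional ℝ F]
  {N : Type*} [TopologicalSpace N] [ChartedSpace F N] [IsManifold 𝓘(ℝ, F) ∞ N]

variable (E F) in
/-- Differentiability at a point of a vector field along a map. -/
def DiffAlong (φ : M → N) (V : Π x : M, TangentSpace 𝓘(ℝ, F) (φ x)) (x : M) : Prop :=
  MDifferentiableAt 𝓘(ℝ, E) 𝓘(ℝ, F).tangent
    (fun x ↦ (⟨φ x, V x⟩ : TangentBundle 𝓘(ℝ, F) N)) x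

variable (E F) in
/-- A vector field along a map that is `C²` at a point. -/
def C2Along (φ : M → N) (V : Π x : M, TangentSpace 𝓘(ℝ, F) (φ x)) (x : M) : Prop :=
  ContMDiffAt 𝓘(ℝ, E) 𝓘(ℝ, F).tangent 2
    (fun x ↦ (⟨φ x, V x⟩ : TangentBundle 𝓘(ℝ, F) N)) x

variable {φ : M → N} {V V' : Π x : M, TangentSpace 𝓘(ℝ, F) (φ x)} {x : M} {f : M → ℝ}

lemma diffAlong_iff : DiffAlong E F φ V x ↔
    MDifferentiableAt 𝓘(ℝ, E) 𝓘(ℝ, F) φ x ∧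
      MDiffAt (fun y ↦ tangentCoord (φ x) (φ y) (V y)) x :=
  mdifferentiableAt_totalSpace 𝓘(ℝ, F) (fun x ↦ (⟨φ x, V x⟩ : TangentBundle 𝓘(ℝ, F) N))

lemma c2Along_iff : C2Along E F φ V x ↔
    ContMDiffAt 𝓘(ℝ, E) 𝓘(ℝ, F) 2 φ x ∧
      CMDiffAt 2 (fun y ↦ tangentCoord (φ x) (φ y) (V y)) x :=
  contMDiffAt_totalSpace

lemma C2Along.diffAlong (h : C2Along E F φ V x) : DiffAlong E F φ V x :=
  ContMDiffAt.mdifferentiableAt h (by simp)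

lemma C2Along.eventually_diffAlong (h : C2Along E F φ V x) :
    ∀ᶠ y in 𝓝 x, DiffAlong E F φ V y := by
  filter_upwards [(contMDiffAt_iff_contMDiffAt_nhds (by simp)).1 h] with y hy
  exact ContMDiffAt.mdifferentiableAt hy (by simp)

lemma DiffAlong.mdifferentiableAt (h : DiffAlong E F φ V x) :
    MDifferentiableAt 𝓘(ℝ, E) 𝓘(ℝ, F) φ x :=
  (diffAlong_iff.1 h).1

lemma DiffAlong.eventually_mem_chart (h : DiffAlong E F φ V x) :
    ∀ᶠ y in 𝓝 x, φ y ∈ (chartAt F (φ x)).source :=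
  h.mdifferentiableAt.continuousAt.eventually (RiemGeom.eventually_mem_chart (E := F) (φ x))

lemma DiffAlong.congr (h : DiffAlong E F φ V x) (hV : ∀ᶠ y in 𝓝 x, V y = V' y) :
    DiffAlong E F φ V' x :=
  MDifferentiableAt.congr_of_eventuallyEq h (hV.mono fun y hy ↦ by simp only [hy])

lemma C2Along.congr (h : C2Along E F φ V x) (hV : ∀ᶠ y in 𝓝 x, V y = V' y) :
    C2Along E F φ V' x :=
  ContMDiffAt.congr_of_eventuallyEq h (hV.mono fun y hy ↦ by simp only [hy])

lemma DiffAlong.add (h : DiffAlong E F φ V x) (h' : DiffAlong E F φ V' x) :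
    DiffAlong E F φ (fun y ↦ V y + V' y) x := by
  refine diffAlong_iff.2 ⟨h.mdifferentiableAt, ?_⟩
  refine ((diffAlong_iff.1 h).2.add (diffAlong_iff.1 h').2).congr_of_eventuallyEq ?_
  filter_upwards [h.eventually_mem_chart] with y hy
  exact tangentCoord_add hy _ _

lemma DiffAlong.smul (hf : MDiffAt f x) (h : DiffAlong E F φ V x) :
    DiffAlong E F φ (fun y ↦ f y • V y) x := by
  refine diffAlong_iff.2 ⟨h.mdifferentiableAt, ?_⟩
  refine (hf.smul (diffAlong_iff.1 h).2).congr_of_eventuallyEq ?_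
  filter_upwards [h.eventually_mem_chart] with y hy
  exact tangentCoord_smul hy _ _

lemma C2Along.add (h : C2Along E F φ V x) (h' : C2Along E F φ V' x) :
    C2Along E F φ (fun y ↦ V y + V' y) x := by
  refine c2Along_iff.2 ⟨(c2Along_iff.1 h).1, ?_⟩
  refine ((c2Along_iff.1 h).2.add (c2Along_iff.1 h').2).congr_of_eventuallyEq ?_
  filter_upwards [h.diffAlong.eventually_mem_chart] with y hy
  exact tangentCoord_add hy _ _

lemma C2Along.smul (hf : CMDiffAt 2 f x) (h : C2Along E F φ V x) :
    C2Along E F φ (fun y ↦ f y • V y) x := by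
  refine c2Along_iff.2 ⟨(c2Along_iff.1 h).1, ?_⟩
  refine (hf.smul (c2Along_iff.1 h).2).congr_of_eventuallyEq ?_
  filter_upwards [h.diffAlong.eventually_mem_chart] with y hy
  exact tangentCoord_smul hy _ _

lemma DiffAlong.comp {W : Π y : N, TangentSpace 𝓘(ℝ, F) y}
    (hφ : MDifferentiableAt 𝓘(ℝ, E) 𝓘(ℝ, F) φ x) (hW : MDiffAt (T% W) (φ x)) :
    DiffAlong E F φ (fun y ↦ W (φ y)) x :=
  MDifferentiableAt.comp x hW hφ

lemma C2Along.comp {W : Π y : N, TangentSpace 𝓘(ℝ, F) y}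
    (hφ : ContMDiffAt 𝓘(ℝ, E) 𝓘(ℝ, F) 2 φ x) (hW : CMDiffAt 2 (T% W) (φ x)) :
    C2Along E F φ (fun y ↦ W (φ y)) x :=
  ContMDiffAt.comp x hW hφ

lemma DiffAlong.zero (hφ : MDifferentiableAt 𝓘(ℝ, E) 𝓘(ℝ, F) φ x) :
    DiffAlong E F φ (fun _ ↦ 0) x :=
  DiffAlong.comp (W := 0) hφ (mdifferentiableAt_zeroSection ..)

lemma DiffAlong.sum {ι : Type*} (s : Finset ι) {V : ι → Π x : M, TangentSpace 𝓘(ℝ, F) (φ x)}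
    (hφ : MDifferentiableAt 𝓘(ℝ, E) 𝓘(ℝ, F) φ x) (h : ∀ i ∈ s, DiffAlong E F φ (V i) x) :
    DiffAlong E F φ (fun y ↦ ∑ i ∈ s, V i y) x := by
  classical
  induction s using Finset.induction_on with
  | empty => simpa using DiffAlong.zero hφ
  | insert a s ha ih =>
    simp only [Finset.mem_insert, forall_eq_or_imp] at h
    simp only [Finset.sum_insert ha]
    exact h.1.add (ih h.2)

/-- The coordinate vector fields of the chart at `y₀`. -/
def coordField (y₀ : N) (a : Fin (Module.finrank ℝ F)) : Π y : N, TangentSpace 𝓘(ℝ, F) y :=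
  extend F (x := y₀) (Module.finBasis ℝ F a)

/-- The coefficients of a vector field along `φ` with respect to the coordinate vector fields of
the chart at `φ x`. -/
def coordCoeff (φ : M → N) (V : Π x : M, TangentSpace 𝓘(ℝ, F) (φ x)) (x : M)
    (a : Fin (Module.finrank ℝ F)) (y : M) : ℝ :=
  (Module.finBasis ℝ F).repr (tangentCoord (φ x) (φ y) (V y)) a

lemma tangentCoord_sum {y₀ y : N} (hy : y ∈ (chartAt F y₀).source) {ι : Type*} (s : Finset ι)
    (v : ι → TangentSpace 𝓘(ℝ, F) y) :
    tangentCoord y₀ y (∑ i ∈ s, v i) = ∑ i ∈ s, tangentCoord y₀ y (v i) :=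
  map_sum ((trivializationAt F (TangentSpace 𝓘(ℝ, F) : N → Type _) y₀).linearEquivAt ℝ y
    (mem_baseSet_of_mem_chart hy)) _ _

lemma tangentCoord_coordField {y₀ y : N} (hy : y ∈ (chartAt F y₀).source)
    (a : Fin (Module.finrank ℝ F)) :
    tangentCoord y₀ y (coordField y₀ a y) = Module.finBasis ℝ F a :=
  (tangentCoord_extend hy _).trans (tangentCoord_self _ _)

lemma eq_sum_coordCoeff {y : M} (hy : φ y ∈ (chartAt F (φ x)).source) :
    V y = ∑ a, coordCoeff φ V x a y • coordField (φ x) a (φ y) := by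
  apply tangentCoord_injective hy
  rw [tangentCoord_sum hy]
  simp only [tangentCoord_smul hy, tangentCoord_coordField hy, coordCoeff]
  exact ((Module.finBasis ℝ F).sum_repr _).symm

lemma DiffAlong.coordCoeff (h : DiffAlong E F φ V x) (a : Fin (Module.finrank ℝ F)) :
    MDiffAt (coordCoeff φ V x a) x := by
  have h1 := (diffAlong_iff.1 h).2
  let L : F →L[ℝ] ℝ := LinearMap.toContinuousLinearMap ((Module.finBasis ℝ F).coord a)
  exact MDifferentiableAt.comp x L.mdifferentiableAt h1

lemma C2Along.coordCoeff (h : C2Along E F φ V x) (a : Fin (Module.finrank ℝ F)) :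
    CMDiffAt 2 (coordCoeff φ V x a) x := by
  have h1 := (c2Along_iff.1 h).2
  let L : F →L[ℝ] ℝ := LinearMap.toContinuousLinearMap ((Module.finBasis ℝ F).coord a)
  exact ContMDiffAt.comp x L.contMDiff.contMDiffAt h1

/-- To prove a property of vector fields along `φ` that is local at `x`, additive, and stable under
multiplication by suitable functions, it suffices to prove it for compositions with `φ` of
coordinate vector fields. -/
lemma along_induction (hφ : ContinuousAt φ x) {R : (M → ℝ) → Prop}
    {P : (Π x : M, TangentSpace 𝓘(ℝ, F) (φ x)) → Prop}
    (congr : ∀ V V', (∀ᶠ y in 𝓝 x, V y = V' y) → P V → P V')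
    (add : ∀ V V', P V → P V' → P (fun y ↦ V y + V' y))
    (smul : ∀ f V, R f → P V → P (fun y ↦ f y • V y))
    (comp : ∀ w : TangentSpace 𝓘(ℝ, F) (φ x), P (fun y ↦ extend F w (φ y)))
    (hV : ∀ a, R (coordCoeff φ V x a)) : P V := by
  classical
  have key (s : Finset (Fin (Module.finrank ℝ F))) :
      P (fun y ↦ ∑ a ∈ s, coordCoeff φ V x a y • coordField (φ x) a (φ y)) := by
    induction s using Finset.induction_on with
    -- `P` is not assumed to hold for the zero field; that field agrees near `x` with the composite
    -- of `extend F 0`.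
    | empty =>
      simp only [Finset.sum_empty]
      refine congr _ _ ?_ (comp 0)
      filter_upwards [hφ.eventually (eventually_mem_chart (E := F) (φ x))] with y hy
      rw [← zero_smul ℝ (0 : TangentSpace 𝓘(ℝ, F) (φ x)), extend_smul hy, zero_smul]
    | insert a s ha ih =>
      simp only [Finset.sum_insert ha]
      exact add _ _ (smul _ _ (hV a) (comp _)) ih
  refine congr _ _ ?_ (key Finset.univ)
  filter_upwards [hφ.eventually (eventually_mem_chart (E := F) (φ x))] with y hy
  exact (eq_sum_coordCoeff hy).symm

end Along

/-! ### The induced connection on vector fields along a map. -/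

section PullbackCov

variable {E : Type*} [NormedAddCommGroup E] [NormedSpace ℝ E] [FiniteDimensional ℝ E]
  {M : Type*} [TopologicalSpace M] [ChartedSpace E M] [IsManifold 𝓘(ℝ, E) ∞ M]
  {F : Type*} [NormedAddCommGroup F] [NormedSpace ℝ F] [FiniteDimensional ℝ F]
  {N : Type*} [TopologicalSpace N] [ChartedSpace F N] [IsManifold 𝓘(ℝ, F) ∞ N]
  [RiemannianBundle (fun y : N ↦ TangentSpace 𝓘(ℝ, F) y)]
  [IsContMDiffRiemannianBundle 𝓘(ℝ, F) ∞ F (fun y : N ↦ TangentSpace 𝓘(ℝ, F) y)]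
  {φ : M → N} {V V' : Π x : M, TangentSpace 𝓘(ℝ, F) (φ x)} {x : M} {f : M → ℝ}

lemma pullbackCov_apply (v : TangentSpace 𝓘(ℝ, E) x) :
    pullbackCov φ V x v =
      (trivializationAt F (fun y : N ↦ TangentSpace 𝓘(ℝ, F) y) (φ x)).symmL ℝ (φ x)
        (mvfderiv 𝓘(ℝ, E) (fun y ↦ tangentCoord (φ x) (φ y) (V y)) x v) +
      leviCivita N (extend F (V x)) (φ x) (mfderiv 𝓘(ℝ, E) 𝓘(ℝ, F) φ x v) := rfl

lemma symmL_tangentCoord (y : N) (v : TangentSpace 𝓘(ℝ, F) y) :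
    (trivializationAt F (fun y : N ↦ TangentSpace 𝓘(ℝ, F) y) y).symmL ℝ y
      (tangentCoord y y v) = v := by
  rw [Trivialization.symmL_apply _ (mem_baseSet_trivializationAt' y)]
  exact Trivialization.symm_apply_apply_mk _ (mem_baseSet_trivializationAt' y) v

/-- The coordinate formula sees only the germ of `V`, so no differentiability is required. By
contrast, `leviCivita_congr` rests on rules stated for differentiable fields. -/
lemma pullbackCov_congr (h : ∀ᶠ y in 𝓝 x, V y = V' y) :
    pullbackCov (E := E) φ V x = pullbackCov φ V' x := by
  ext1 v
  rw [pullbackCov_apply, pullbackCov_apply, h.self_of_nhds, mvfderiv_congr]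
  filter_upwards [h] with y hy
  rw [hy]

lemma pullbackCov_add (h : DiffAlong E F φ V x) (h' : DiffAlong E F φ V' x) :
    pullbackCov (E := E) φ (fun y ↦ V y + V' y) x = pullbackCov φ V x + pullbackCov φ V' x := by
  have h1 : mvfderiv 𝓘(ℝ, E) (fun y ↦ tangentCoord (φ x) (φ y) (V y + V' y)) x =
      mvfderiv 𝓘(ℝ, E) (fun y ↦ tangentCoord (φ x) (φ y) (V y)) x +
      mvfderiv 𝓘(ℝ, E) (fun y ↦ tangentCoord (φ x) (φ y) (V' y)) x := by
    rw [← mvfderiv_add (diffAlong_iff.1 h).2 (diffAlong_iff.1 h').2]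
    refine mvfderiv_congr ?_
    filter_upwards [h.eventually_mem_chart] with y hy
    exact tangentCoord_add hy _ _
  have h2 : leviCivita N (extend F (V x + V' x)) (φ x) =
      leviCivita N (extend F (V x)) (φ x) + leviCivita N (extend F (V' x)) (φ x) := by
    rw [← leviCivita_add (mdifferentiableAt_extend _ _ _) (mdifferentiableAt_extend _ _ _)]
    refine leviCivita_congr (mdifferentiableAt_extend _ _ _) (mdifferentiableAt_add_section
      (mdifferentiableAt_extend _ _ _) (mdifferentiableAt_extend _ _ _)) ?_
    filter_upwards [eventually_mem_chart (E := F) (φ x)] with y hy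
    exact extend_add hy _ _
  ext1 v
  rw [add_apply, pullbackCov_apply, pullbackCov_apply, pullbackCov_apply, h1, h2, add_apply,
    add_apply, map_add]
  abel

lemma pullbackCov_smul (hf : MDiffAt f x) (h : DiffAlong E F φ V x)
    (v : TangentSpace 𝓘(ℝ, E) x) :
    pullbackCov φ (fun y ↦ f y • V y) x v =
      f x • pullbackCov φ V x v + mvfderiv 𝓘(ℝ, E) f x v • V x := by
  have h1 : mvfderiv 𝓘(ℝ, E) (fun y ↦ tangentCoord (φ x) (φ y) (f y • V y)) x =
      f x • mvfderiv 𝓘(ℝ, E) (fun y ↦ tangentCoord (φ x) (φ y) (V y)) x +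
      (mvfderiv 𝓘(ℝ, E) f x).smulRight (tangentCoord (φ x) (φ x) (V x)) := by
    rw [← mvfderiv_smul hf (diffAlong_iff.1 h).2]
    refine mvfderiv_congr ?_
    filter_upwards [h.eventually_mem_chart] with y hy
    exact tangentCoord_smul hy _ _
  have h2 : leviCivita N (extend F (f x • V x)) (φ x) =
      f x • leviCivita N (extend F (V x)) (φ x) := by
    rw [← leviCivita_const_smul _ (mdifferentiableAt_extend _ _ _)]
    refine leviCivita_congr (mdifferentiableAt_extend _ _ _)
      (mdifferentiableAt_const.smul_section (mdifferentiableAt_extend _ _ _)) ?_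
    filter_upwards [eventually_mem_chart (E := F) (φ x)] with y hy
    exact extend_smul hy _ _
  rw [pullbackCov_apply, pullbackCov_apply, h1, h2, add_apply, map_add, smul_apply, smul_apply,
    map_smul, ContinuousLinearMap.smulRight_apply, map_smul, symmL_tangentCoord, smul_add]
  abel

/-- Subtracting the coordinate derivative from `∇_w` leaves a tensorial operator, as both satisfy
the same Leibniz rule. It may therefore be evaluated on `extend F (W y)`, whose coordinate
derivative is zero: this is the Christoffel term. -/
lemma leviCivita_eq_coord {y : N} {W : Π y : N, TangentSpace 𝓘(ℝ, F) y} (hW : MDiffAt (T% W) y)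
    (w : TangentSpace 𝓘(ℝ, F) y) :
    leviCivita N W y w =
      (trivializationAt F (fun y : N ↦ TangentSpace 𝓘(ℝ, F) y) y).symmL ℝ y
        (mvfderiv 𝓘(ℝ, F) (fun z ↦ tangentCoord y z (W z)) y w) +
      leviCivita N (extend F (W y)) y w := by
  set S := (trivializationAt F (fun y : N ↦ TangentSpace 𝓘(ℝ, F) y) y).symmL ℝ y with hS
  have hT : TensorialAt 𝓘(ℝ, F) F (fun W : Π y : N, TangentSpace 𝓘(ℝ, F) y ↦
      leviCivita N W y w - S (mvfderiv 𝓘(ℝ, F) (fun z ↦ tangentCoord y z (W z)) y w)) y := by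
    constructor
    · intro f W hf hW
      have h1 : mvfderiv 𝓘(ℝ, F) (fun z ↦ tangentCoord y z ((f • W) z)) y =
          f y • mvfderiv 𝓘(ℝ, F) (fun z ↦ tangentCoord y z (W z)) y +
          (mvfderiv 𝓘(ℝ, F) f y).smulRight (tangentCoord y y (W y)) := by
        rw [← mvfderiv_smul hf (mdifferentiableAt_tangentCoord hW)]
        refine mvfderiv_congr ?_
        filter_upwards [eventually_mem_chart (E := F) y] with z hz
        exact tangentCoord_smul hz _ _
      rw [leviCivita_smul hf hW, h1]
      simp only [add_apply, smul_apply, ContinuousLinearMap.smulRight_apply, map_add, map_smul]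
      rw [hS, symmL_tangentCoord, smul_sub]
      abel
    · intro W W' hW hW'
      have h1 : mvfderiv 𝓘(ℝ, F) (fun z ↦ tangentCoord y z ((W + W') z)) y =
          mvfderiv 𝓘(ℝ, F) (fun z ↦ tangentCoord y z (W z)) y +
          mvfderiv 𝓘(ℝ, F) (fun z ↦ tangentCoord y z (W' z)) y := by
        rw [← mvfderiv_add (mdifferentiableAt_tangentCoord hW) (mdifferentiableAt_tangentCoord hW')]
        refine mvfderiv_congr ?_
        filter_upwards [eventually_mem_chart (E := F) y] with z hz
        exact tangentCoord_add hz _ _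
      rw [leviCivita_add hW hW', h1]
      simp only [add_apply, map_add]
      abel
  have h := hT.pointwise hW (mdifferentiableAt_extend 𝓘(ℝ, F) F (W y)) (by simp)
  have h0 : mvfderiv 𝓘(ℝ, F) (fun z ↦ tangentCoord y z (extend F (W y) z)) y = 0 := by
    rw [← mvfderiv_const (I := 𝓘(ℝ, F)) (tangentCoord y y (W y)) (x := y)]
    refine mvfderiv_congr ?_
    filter_upwards [eventually_mem_chart (E := F) y] with z hz
    exact tangentCoord_extend hz _
  simp only [h0, zero_apply, map_zero, sub_zero] at h
  rw [← h]
  abel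

/-- Chain rule for the coordinate part; the Christoffel parts agree. This characterizes the induced
connection and is the base case of every induction along `φ`. -/
lemma pullbackCov_comp {W : Π y : N, TangentSpace 𝓘(ℝ, F) y}
    (hφ : MDifferentiableAt 𝓘(ℝ, E) 𝓘(ℝ, F) φ x) (hW : MDiffAt (T% W) (φ x))
    (v : TangentSpace 𝓘(ℝ, E) x) :
    pullbackCov φ (fun y ↦ W (φ y)) x v =
      leviCivita N W (φ x) (mfderiv 𝓘(ℝ, E) 𝓘(ℝ, F) φ x v) := by
  rw [pullbackCov_apply, leviCivita_eq_coord hW]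
  congr 2
  exact mfderiv_comp_apply x (mdifferentiableAt_tangentCoord hW) hφ v

lemma DiffAlong.inner (h : DiffAlong E F φ V x) (h' : DiffAlong E F φ V' x) :
    MDiffAt (fun y ↦ (inner ℝ (V y) (V' y) : ℝ)) x :=
  MDifferentiableAt.inner_bundle (IB := 𝓘(ℝ, F)) (F := F)
    (E := fun y : N ↦ TangentSpace 𝓘(ℝ, F) y) h h'

lemma pullbackCov_zero (hφ : MDifferentiableAt 𝓘(ℝ, E) 𝓘(ℝ, F) φ x)
    (v : TangentSpace 𝓘(ℝ, E) x) :
    pullbackCov φ (fun y ↦ (0 : TangentSpace 𝓘(ℝ, F) (φ y))) x v = 0 := by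
  have h := pullbackCov_smul (F := F) (f := fun _ ↦ 0) mdifferentiableAt_const
    (DiffAlong.zero hφ) v
  simpa using h

lemma pullbackCov_sum {ι : Type*} (s : Finset ι) {V : ι → Π x : M, TangentSpace 𝓘(ℝ, F) (φ x)}
    (hφ : MDifferentiableAt 𝓘(ℝ, E) 𝓘(ℝ, F) φ x) (h : ∀ i ∈ s, DiffAlong E F φ (V i) x)
    (v : TangentSpace 𝓘(ℝ, E) x) :
    pullbackCov φ (fun y ↦ ∑ i ∈ s, V i y) x v = ∑ i ∈ s, pullbackCov φ (V i) x v := by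
  classical
  induction s using Finset.induction_on with
  | empty => simpa using pullbackCov_zero hφ v
  | insert a s ha ih =>
    simp only [Finset.mem_insert, forall_eq_or_imp] at h
    simp only [Finset.sum_insert ha]
    rw [pullbackCov_add h.1 (DiffAlong.sum s hφ h.2), add_apply, ih h.2]

/-- The induced connection is metric. -/
lemma mvfderiv_inner_along (h : DiffAlong E F φ V x) (h' : DiffAlong E F φ V' x)
    (v : TangentSpace 𝓘(ℝ, E) x) :
    mvfderiv 𝓘(ℝ, E) (fun y ↦ (inner ℝ (V y) (V' y) : ℝ)) x v =
      inner ℝ (pullbackCov φ V x v) (V' x) + inner ℝ (V x) (pullbackCov φ V' x v) := by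
  have hφ := h.mdifferentiableAt
  have key {V V' : Π x : M, TangentSpace 𝓘(ℝ, F) (φ x)} (h : DiffAlong E F φ V x)
      (h' : DiffAlong E F φ V' x)
      (base : ∀ w : TangentSpace 𝓘(ℝ, F) (φ x),
        mvfderiv 𝓘(ℝ, E) (fun y ↦ (inner ℝ (extend F w (φ y)) (V' y) : ℝ)) x v =
          inner ℝ (pullbackCov φ (fun y ↦ extend F w (φ y)) x v) (V' x) +
            inner ℝ (extend F w (φ x)) (pullbackCov φ V' x v)) :
      mvfderiv 𝓘(ℝ, E) (fun y ↦ (inner ℝ (V y) (V' y) : ℝ)) x v =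
        inner ℝ (pullbackCov φ V x v) (V' x) + inner ℝ (V x) (pullbackCov φ V' x v) := by
    refine (along_induction (V := V) (P := fun V ↦ DiffAlong E F φ V x ∧
      mvfderiv 𝓘(ℝ, E) (fun y ↦ (inner ℝ (V y) (V' y) : ℝ)) x v =
        inner ℝ (pullbackCov φ V x v) (V' x) + inner ℝ (V x) (pullbackCov φ V' x v))
      (R := fun f ↦ MDiffAt f x) hφ.continuousAt ?_ ?_ ?_ ?_ h.coordCoeff).2
    · rintro V₁ V₂ heq ⟨h₁, e₁⟩
      refine ⟨h₁.congr heq, ?_⟩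
      rw [← pullbackCov_congr heq, ← heq.self_of_nhds, ← e₁, mvfderiv_congr]
      filter_upwards [heq] with y hy
      rw [hy]
    · rintro V₁ V₂ ⟨h₁, e₁⟩ ⟨h₂, e₂⟩
      refine ⟨h₁.add h₂, ?_⟩
      have : (fun y ↦ (inner ℝ (V₁ y + V₂ y) (V' y) : ℝ)) =
          (fun y ↦ (inner ℝ (V₁ y) (V' y) : ℝ)) + fun y ↦ (inner ℝ (V₂ y) (V' y) : ℝ) := by
        ext y
        simp [inner_add_left]
      rw [this, mvfderiv_add (h₁.inner h') (h₂.inner h'), add_apply, e₁, e₂,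
        pullbackCov_add h₁ h₂, add_apply, inner_add_left, inner_add_left]
      ring
    · rintro f V₁ hf ⟨h₁, e₁⟩
      refine ⟨h₁.smul hf, ?_⟩
      have : (fun y ↦ (inner ℝ (f y • V₁ y) (V' y) : ℝ)) =
          f * fun y ↦ (inner ℝ (V₁ y) (V' y) : ℝ) := by
        ext y
        simp [real_inner_smul_left]
      rw [this, mvfderiv_mul hf (h₁.inner h'), add_apply, smul_apply, smul_apply, e₁,
        pullbackCov_smul hf h₁, inner_add_left, real_inner_smul_left, real_inner_smul_left,
        real_inner_smul_left, smul_eq_mul, smul_eq_mul]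
      ring
    · exact fun w ↦ ⟨DiffAlong.comp hφ (mdifferentiableAt_extend _ _ w), base w⟩
  have symm {V V' : Π x : M, TangentSpace 𝓘(ℝ, F) (φ x)}
      (h : mvfderiv 𝓘(ℝ, E) (fun y ↦ (inner ℝ (V y) (V' y) : ℝ)) x v =
        inner ℝ (pullbackCov φ V x v) (V' x) + inner ℝ (V x) (pullbackCov φ V' x v)) :
      mvfderiv 𝓘(ℝ, E) (fun y ↦ (inner ℝ (V' y) (V y) : ℝ)) x v =
        inner ℝ (pullbackCov φ V' x v) (V x) + inner ℝ (V' x) (pullbackCov φ V x v) := by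
    have : (fun y ↦ (inner ℝ (V' y) (V y) : ℝ)) = fun y ↦ (inner ℝ (V y) (V' y) : ℝ) := by
      ext y
      exact real_inner_comm _ _
    rw [this, h, real_inner_comm (V' x), real_inner_comm _ (V x)]
    ring
  -- `key` replaces the first argument by a composite; applying it once more after exchanging the
  -- arguments replaces the second. For two composites the claim is metric compatibility on `N` and
  -- the chain rule.
  refine key h h' fun w ↦ symm (key h' (DiffAlong.comp hφ (mdifferentiableAt_extend _ _ w))
    fun w' ↦ ?_)
  have hw := mdifferentiableAt_extend 𝓘(ℝ, F) F w
  have hw' := mdifferentiableAt_extend 𝓘(ℝ, F) F w'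
  rw [pullbackCov_comp hφ hw, pullbackCov_comp hφ hw', ← mvfderiv_inner hw' hw]
  exact mfderiv_comp_apply x (inner_mdiff hw' hw) hφ v

end PullbackCov

/-! ### Second derivatives along a map: symmetry of the Hessian and the Ricci identity. -/

section Hessian

variable {E : Type*} [NormedAddCommGroup E] [NormedSpace ℝ E] [FiniteDimensional ℝ E]
  {M : Type*} [TopologicalSpace M] [ChartedSpace E M] [IsManifold 𝓘(ℝ, E) ∞ M]
  [RiemannianBundle (fun x : M ↦ TangentSpace 𝓘(ℝ, E) x)]
  [IsContMDiffRiemannianBundle 𝓘(ℝ, E) ∞ E (fun x : M ↦ TangentSpace 𝓘(ℝ, E) x)]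
  {F : Type*} [NormedAddCommGroup F] [NormedSpace ℝ F] [FiniteDimensional ℝ F]
  {N : Type*} [TopologicalSpace N] [ChartedSpace F N] [IsManifold 𝓘(ℝ, F) ∞ N]
  [RiemannianBundle (fun y : N ↦ TangentSpace 𝓘(ℝ, F) y)]
  [IsContMDiffRiemannianBundle 𝓘(ℝ, F) ∞ F (fun y : N ↦ TangentSpace 𝓘(ℝ, F) y)]
  {φ : M → N} {V : Π x : M, TangentSpace 𝓘(ℝ, F) (φ x)} {x : M}
  {Y : Π x : M, TangentSpace 𝓘(ℝ, E) x}

/-- The components of a map in the chart at `φ x`. -/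
def mapCoord (φ : M → N) (x : M) (c : Fin (Module.finrank ℝ F)) (y : M) : ℝ :=
  (Module.finBasis ℝ F).repr (extChartAt 𝓘(ℝ, F) (φ x) (φ y)) c

lemma contMDiffAt_mapCoord (hφ : ContMDiff 𝓘(ℝ, E) 𝓘(ℝ, F) ∞ φ) (c : Fin (Module.finrank ℝ F)) :
    CMDiffAt ∞ (mapCoord φ x c) x := by
  let L : F →L[ℝ] ℝ := LinearMap.toContinuousLinearMap ((Module.finBasis ℝ F).coord c)
  exact ContMDiffAt.comp x L.contMDiff.contMDiffAt
    (ContMDiffAt.comp x (contMDiffAt_extChartAt (n := ∞)) (hφ x))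

lemma contMDiffAt_mapCoord_two (hφ : ContMDiff 𝓘(ℝ, E) 𝓘(ℝ, F) ∞ φ)
    (c : Fin (Module.finrank ℝ F)) : CMDiffAt 2 (mapCoord φ x c) x :=
  (contMDiffAt_mapCoord hφ c).of_le (WithTop.coe_le_coe.2 le_top)

lemma mfderiv_eq_sum (hφ : ContMDiff 𝓘(ℝ, E) 𝓘(ℝ, F) ∞ φ) {y : M}
    (hy : φ y ∈ (chartAt F (φ x)).source) (v : TangentSpace 𝓘(ℝ, E) y) :
    mfderiv 𝓘(ℝ, E) 𝓘(ℝ, F) φ y v =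
      ∑ c, mvfderiv 𝓘(ℝ, E) (mapCoord φ x c) y v • coordField (φ x) c (φ y) := by
  have hφy : MDifferentiableAt 𝓘(ℝ, E) 𝓘(ℝ, F) φ y := (hφ y).mdifferentiableAt (by simp)
  apply tangentCoord_injective hy
  rw [tangentCoord_sum hy]
  simp only [tangentCoord_smul hy, tangentCoord_coordField hy]
  rw [← (Module.finBasis ℝ F).sum_repr (tangentCoord (φ x) (φ y) _)]
  refine Finset.sum_congr rfl fun c _ ↦ ?_
  congr 1
  have hχ : MDifferentiableAt 𝓘(ℝ, F) 𝓘(ℝ, F) (extChartAt 𝓘(ℝ, F) (φ x)) (φ y) :=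
    mdifferentiableAt_extChartAt hy
  let L : F →L[ℝ] ℝ := LinearMap.toContinuousLinearMap ((Module.finBasis ℝ F).coord c)
  have h1 := mfderiv_comp_apply y
    (L.mdifferentiableAt (x := extChartAt 𝓘(ℝ, F) (φ x) (φ y))) (hχ.comp y hφy) v
  rw [mfderiv_comp_apply y hχ hφy v, mfderiv_extChartAt_apply hy, L.mfderiv_eq] at h1
  exact h1.symm

lemma eventually_mem_chart_map (hφ : ContMDiff 𝓘(ℝ, E) 𝓘(ℝ, F) ∞ φ) :
    ∀ᶠ y in 𝓝 x, φ y ∈ (chartAt F (φ x)).source :=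
  (hφ x).continuousAt.eventually (eventually_mem_chart (E := F) (φ x))

/-- The image of a differentiable vector field under the differential is differentiable. -/
lemma diffAlong_mfderiv (hφ : ContMDiff 𝓘(ℝ, E) 𝓘(ℝ, F) ∞ φ) (hY : MDiffAt (T% Y) x) :
    DiffAlong E F φ (fun y ↦ mfderiv 𝓘(ℝ, E) 𝓘(ℝ, F) φ y (Y y)) x := by
  have hφx : MDifferentiableAt 𝓘(ℝ, E) 𝓘(ℝ, F) φ x := (hφ x).mdifferentiableAt (by simp)
  refine (DiffAlong.sum Finset.univ hφx (V := fun c y ↦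
    mvfderiv 𝓘(ℝ, E) (mapCoord φ x c) y (Y y) • coordField (φ x) c (φ y)) fun c _ ↦
      DiffAlong.smul (mdifferentiableAt_mvfderiv_apply (contMDiffAt_mapCoord_two hφ c) hY)
        (DiffAlong.comp hφx (mdifferentiableAt_extend _ _ _))).congr ?_
  filter_upwards [eventually_mem_chart_map hφ] with y hy
  exact (mfderiv_eq_sum hφ hy _).symm

/-- The identity holds in a neighbourhood, not only at `x`, so it can be differentiated a second
time. -/
lemma pullbackCov_extend_eq_sum (hφ : ContMDiff 𝓘(ℝ, E) 𝓘(ℝ, F) ∞ φ)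
    (w : TangentSpace 𝓘(ℝ, F) (φ x)) (Y : Π x : M, TangentSpace 𝓘(ℝ, E) x) :
    ∀ᶠ y in 𝓝 x, pullbackCov φ (fun y ↦ extend F w (φ y)) y (Y y) =
      ∑ c, mvfderiv 𝓘(ℝ, E) (mapCoord φ x c) y (Y y) •
        leviCivita N (extend F w) (φ y) (coordField (φ x) c (φ y)) := by
  filter_upwards [eventually_mem_chart_map hφ,
    (hφ x).continuousAt.eventually (eventually_mdiff_extend w)] with y hy hw
  rw [pullbackCov_comp ((hφ y).mdifferentiableAt (by simp)) hw, mfderiv_eq_sum hφ hy, map_sum]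
  simp only [map_smul]

/-- The covariant derivative of a `C²` vector field along `φ` in the direction of a differentiable
vector field is differentiable. -/
lemma diffAlong_pullbackCov (hφ : ContMDiff 𝓘(ℝ, E) 𝓘(ℝ, F) ∞ φ) (hV : C2Along E F φ V x)
    (hY : MDiffAt (T% Y) x) : DiffAlong E F φ (fun y ↦ pullbackCov φ V y (Y y)) x := by
  have hφx : MDifferentiableAt 𝓘(ℝ, E) 𝓘(ℝ, F) φ x := (hφ x).mdifferentiableAt (by simp)
  refine (along_induction (V := V) (P := fun V ↦ C2Along E F φ V x ∧
    DiffAlong E F φ (fun y ↦ pullbackCov φ V y (Y y)) x) (R := fun f ↦ CMDiffAt 2 f x)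
    (hφ x).continuousAt ?_ ?_ ?_ ?_ hV.coordCoeff).2
  · rintro V₁ V₂ heq ⟨h₁, e₁⟩
    refine ⟨h₁.congr heq, e₁.congr ?_⟩
    filter_upwards [heq.eventually_nhds] with y hy
    rw [pullbackCov_congr hy]
  · rintro V₁ V₂ ⟨h₁, e₁⟩ ⟨h₂, e₂⟩
    refine ⟨h₁.add h₂, (e₁.add e₂).congr ?_⟩
    filter_upwards [h₁.eventually_diffAlong, h₂.eventually_diffAlong] with y h1 h2
    rw [pullbackCov_add h1 h2, add_apply]
  · rintro f V₁ hf ⟨h₁, e₁⟩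
    refine ⟨h₁.smul hf, ((e₁.smul (hf.mdifferentiableAt (by simp))).add
      (h₁.diffAlong.smul (mdifferentiableAt_mvfderiv_apply hf hY))).congr ?_⟩
    filter_upwards [h₁.eventually_diffAlong, eventually_mdifferentiableAt hf (by norm_num)]
      with y h1 h2
    rw [pullbackCov_smul h2 h1]
  · intro w
    refine ⟨C2Along.comp ((hφ x).of_le (WithTop.coe_le_coe.2 le_top))
      (contMDiffAt_extend _ _ w), (DiffAlong.sum Finset.univ hφx (V := fun c y ↦
        mvfderiv 𝓘(ℝ, E) (mapCoord φ x c) y (Y y) •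
          leviCivita N (extend F w) (φ y) (coordField (φ x) c (φ y))) fun c _ ↦
      DiffAlong.smul (mdifferentiableAt_mvfderiv_apply (contMDiffAt_mapCoord_two hφ c) hY)
        (DiffAlong.comp hφx (mdifferentiableAt_leviCivita_extend _ _))).congr ?_⟩
    filter_upwards [pullbackCov_extend_eq_sum hφ w Y] with y hy
    exact hy.symm

lemma leviCivita_extend_comm (u v : TangentSpace 𝓘(ℝ, E) x) :
    leviCivita M (extend E v) x u = leviCivita M (extend E u) x v := by
  have h := leviCivita_sub_eq_mlieBracket (mdifferentiableAt_extend 𝓘(ℝ, E) E u)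
    (mdifferentiableAt_extend 𝓘(ℝ, E) E v)
  rw [mlieBracket_extend (mem_chart_source E x), extend_apply_self, extend_apply_self] at h
  exact sub_eq_zero.1 h

lemma coordField_self (y₀ : N) (c : Fin (Module.finrank ℝ F)) :
    coordField y₀ c y₀ = Module.finBasis ℝ F c :=
  extend_apply_self (F := F) (x := y₀) _

lemma extend_eq_sum (w : TangentSpace 𝓘(ℝ, F) (φ x)) {a : Fin (Module.finrank ℝ F) → ℝ}
    (hw : w = ∑ c, a c • coordField (φ x) c (φ x)) {y : N} (hy : y ∈ (chartAt F (φ x)).source) :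
    extend F w y = ∑ c, a c • coordField (φ x) c y := by
  apply tangentCoord_injective hy
  rw [tangentCoord_extend hy, hw, tangentCoord_sum hy, tangentCoord_sum (mem_chart_source F _)]
  simp only [tangentCoord_smul hy, tangentCoord_smul (mem_chart_source F _),
    tangentCoord_coordField hy, tangentCoord_coordField (mem_chart_source F _)]

/-- In coordinates `∇̄_u (dφ v)` is the second derivative of the components of `φ` plus Christoffel
terms quadratic in `dφ`. The former are symmetric because coordinate fields commute, the latter
because the connection of `N` is torsion-free. This is the symmetry of `B_φ`. -/
lemma pullbackCov_mfderiv_extend_comm (hφ : ContMDiff 𝓘(ℝ, E) 𝓘(ℝ, F) ∞ φ)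
    (u v : TangentSpace 𝓘(ℝ, E) x) :
    pullbackCov φ (fun y ↦ mfderiv 𝓘(ℝ, E) 𝓘(ℝ, F) φ y (extend E v y)) x u =
      pullbackCov φ (fun y ↦ mfderiv 𝓘(ℝ, E) 𝓘(ℝ, F) φ y (extend E u y)) x v := by
  have hφx : MDifferentiableAt 𝓘(ℝ, E) 𝓘(ℝ, F) φ x := (hφ x).mdifferentiableAt (by simp)
  have key (u v : TangentSpace 𝓘(ℝ, E) x) :
      pullbackCov φ (fun y ↦ mfderiv 𝓘(ℝ, E) 𝓘(ℝ, F) φ y (extend E v y)) x u =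
      ∑ c, mvfderiv 𝓘(ℝ, E) (fun y ↦ mvfderiv 𝓘(ℝ, E) (mapCoord φ x c) y (extend E v y)) x u •
        coordField (φ x) c (φ x) +
      ∑ c, ∑ d, (mvfderiv 𝓘(ℝ, E) (mapCoord φ x c) x v * mvfderiv 𝓘(ℝ, E) (mapCoord φ x d) x u) •
        leviCivita N (coordField (φ x) c) (φ x) (coordField (φ x) d (φ x)) := by
    have hd (c) := mdifferentiableAt_mvfderiv_apply (contMDiffAt_mapCoord_two hφ c)
      (mdifferentiableAt_extend 𝓘(ℝ, E) E v)
    have hE (c : Fin (Module.finrank ℝ F)) : MDiffAt (T% (coordField (φ x) c)) (φ x) := mdifferentiableAt_extend _ _ _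
    rw [pullbackCov_congr (V' := fun y ↦ ∑ c, mvfderiv 𝓘(ℝ, E) (mapCoord φ x c) y (extend E v y) •
      coordField (φ x) c (φ y)) ((eventually_mem_chart_map hφ).mono fun y hy ↦
        mfderiv_eq_sum hφ hy _), pullbackCov_sum _ hφx fun c _ ↦
          DiffAlong.smul (hd c) (DiffAlong.comp hφx (hE c)), ← Finset.sum_add_distrib]
    refine Finset.sum_congr rfl fun c _ ↦ ?_
    rw [pullbackCov_smul (hd c) (DiffAlong.comp hφx (hE c)), pullbackCov_comp hφx (hE c),
      mfderiv_eq_sum hφ (mem_chart_source F (φ x)) u, map_sum, Finset.smul_sum, add_comm,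
      extend_apply_self]
    congr 1
    refine Finset.sum_congr rfl fun d _ ↦ ?_
    rw [map_smul, smul_smul]
  rw [key, key]
  congr 1
  · refine Finset.sum_congr rfl fun c _ ↦ ?_
    rw [mvfderiv_mvfderiv_extend_comm (contMDiffAt_mapCoord_two hφ c)]
  · rw [Finset.sum_comm]
    refine Finset.sum_congr rfl fun c _ ↦ Finset.sum_congr rfl fun d _ ↦ ?_
    rw [mul_comm]
    congr 1
    rw [coordField_self, coordField_self]
    exact leviCivita_extend_comm (E := F) (x := φ x) _ _

lemma curvature_add_right {y : N} (u v w w' : TangentSpace 𝓘(ℝ, F) y) :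
    curvature y u v (w + w') = curvature y u v w + curvature y u v w' := by
  refine ext_inner_right ℝ fun z ↦ ?_
  rw [inner_add_left, inner_curvature_swap, inner_curvature_swap _ _ w,
    inner_curvature_swap _ _ w', inner_add_right, neg_add]

lemma curvature_smul_right {y : N} (c : ℝ) (u v w : TangentSpace 𝓘(ℝ, F) y) :
    curvature y u v (c • w) = c • curvature y u v w := by
  refine ext_inner_right ℝ fun z ↦ ?_
  rw [real_inner_smul_left, inner_curvature_swap, inner_curvature_swap _ _ w,
    real_inner_smul_right, mul_neg]

/-- Base case of the Ricci identity. Differentiating `∇̄_v (W ∘ φ) = ∑ dφ^c(v) (∇_{E_c} W) ∘ φ`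
gives a Hessian term symmetric in `u, v` and the second derivative of `W` on `N`; antisymmetrizing
leaves the curvature. -/
lemma pullbackCov_pullbackCov_comp_sub (hφ : ContMDiff 𝓘(ℝ, E) 𝓘(ℝ, F) ∞ φ)
    (w : TangentSpace 𝓘(ℝ, F) (φ x)) (u v : TangentSpace 𝓘(ℝ, E) x) :
    pullbackCov φ (fun y ↦ pullbackCov φ (fun y ↦ extend F w (φ y)) y (extend E v y)) x u -
        pullbackCov φ (fun y ↦ pullbackCov φ (fun y ↦ extend F w (φ y)) y (extend E u y)) x v =
      curvature (φ x) (mfderiv 𝓘(ℝ, E) 𝓘(ℝ, F) φ x u) (mfderiv 𝓘(ℝ, E) 𝓘(ℝ, F) φ x v) w := by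
  have hφx : MDifferentiableAt 𝓘(ℝ, E) 𝓘(ℝ, F) φ x := (hφ x).mdifferentiableAt (by simp)
  have hW (c) : MDiffAt (T% (fun z ↦ leviCivita N (extend F w) z (coordField (φ x) c z))) (φ x) :=
    mdifferentiableAt_leviCivita_extend _ _
  have key (u v : TangentSpace 𝓘(ℝ, E) x) :
      pullbackCov φ (fun y ↦ pullbackCov φ (fun y ↦ extend F w (φ y)) y (extend E v y)) x u =
      ∑ c, mvfderiv 𝓘(ℝ, E) (fun y ↦ mvfderiv 𝓘(ℝ, E) (mapCoord φ x c) y (extend E v y)) x u •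
        leviCivita N (extend F w) (φ x) (coordField (φ x) c (φ x)) +
      leviCivita N (fun z ↦ leviCivita N (extend F w) z
        (extend F (mfderiv 𝓘(ℝ, E) 𝓘(ℝ, F) φ x v) z)) (φ x)
          (mfderiv 𝓘(ℝ, E) 𝓘(ℝ, F) φ x u) := by
    have hd (c) := mdifferentiableAt_mvfderiv_apply (contMDiffAt_mapCoord_two hφ c)
      (mdifferentiableAt_extend 𝓘(ℝ, E) E v)
    have h2 : leviCivita N (fun z ↦ leviCivita N (extend F w) z
        (extend F (mfderiv 𝓘(ℝ, E) 𝓘(ℝ, F) φ x v) z)) (φ x) =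
        leviCivita N (fun z ↦ ∑ c, (fun _ ↦ mvfderiv 𝓘(ℝ, E) (mapCoord φ x c) x v : N → ℝ) z •
          leviCivita N (extend F w) z (coordField (φ x) c z)) (φ x) := by
      refine leviCivita_congr (mdifferentiableAt_leviCivita_extend _ _)
        (MDifferentiableAt.sum_section fun c _ ↦ mdifferentiableAt_const.smul_section (hW c)) ?_
      filter_upwards [eventually_mem_chart (E := F) (φ x)] with z hz
      rw [extend_eq_sum _ (mfderiv_eq_sum hφ (mem_chart_source F (φ x)) v) hz, map_sum]
      simp only [map_smul]
      rfl
    rw [h2, leviCivita_sum _ (fun c _ ↦ mdifferentiableAt_const) (fun c _ ↦ hW c),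
      pullbackCov_congr (pullbackCov_extend_eq_sum hφ w _), pullbackCov_sum _ hφx fun c _ ↦
        DiffAlong.smul (hd c) (DiffAlong.comp hφx (hW c)), sum_apply,
      ← Finset.sum_add_distrib]
    refine Finset.sum_congr rfl fun c _ ↦ ?_
    rw [pullbackCov_smul (hd c) (DiffAlong.comp hφx (hW c)), pullbackCov_comp hφx (hW c),
      add_apply, smul_apply, mvfderiv_const, extend_apply_self]
    simp [add_comm]
  rw [key, key, curvature_eq]
  have hcomm (c) := mvfderiv_mvfderiv_extend_comm (contMDiffAt_mapCoord_two (x := x) hφ c) u v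
  simp only [hcomm]
  abel

/-- The Ricci identity for vector fields along a map. -/
lemma secondCov_sub_secondCov (hφ : ContMDiff 𝓘(ℝ, E) 𝓘(ℝ, F) ∞ φ) (hV : C2Along E F φ V x)
    (u v : TangentSpace 𝓘(ℝ, E) x) :
    secondCov φ V x u v - secondCov φ V x v u =
      curvature (φ x) (mfderiv 𝓘(ℝ, E) 𝓘(ℝ, F) φ x u) (mfderiv 𝓘(ℝ, E) 𝓘(ℝ, F) φ x v) (V x) := by
  -- The corrections `∇̄_{∇_u v} V` cancel because the extensions of `u` and `v` commute.
  rw [secondCov, secondCov, leviCivita_extend_comm u v, sub_sub_sub_cancel_right]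
  have hext (v : TangentSpace 𝓘(ℝ, E) x) := mdifferentiableAt_extend 𝓘(ℝ, E) E v
  refine (along_induction (V := V) (P := fun V ↦ C2Along E F φ V x ∧
    pullbackCov φ (fun y ↦ pullbackCov φ V y (extend E v y)) x u -
      pullbackCov φ (fun y ↦ pullbackCov φ V y (extend E u y)) x v =
    curvature (φ x) (mfderiv 𝓘(ℝ, E) 𝓘(ℝ, F) φ x u) (mfderiv 𝓘(ℝ, E) 𝓘(ℝ, F) φ x v) (V x))
    (R := fun f ↦ CMDiffAt 2 f x) (hφ x).continuousAt ?_ ?_ ?_ ?_ hV.coordCoeff).2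
  · rintro V₁ V₂ heq ⟨h₁, e₁⟩
    refine ⟨h₁.congr heq, ?_⟩
    have h (v : TangentSpace 𝓘(ℝ, E) x) : ∀ᶠ y in 𝓝 x,
        pullbackCov φ V₁ y (extend E v y) = pullbackCov φ V₂ y (extend E v y) := by
      filter_upwards [heq.eventually_nhds] with y hy
      rw [pullbackCov_congr hy]
    rw [← pullbackCov_congr (h u), ← pullbackCov_congr (h v), e₁, heq.self_of_nhds]
  · rintro V₁ V₂ ⟨h₁, e₁⟩ ⟨h₂, e₂⟩
    refine ⟨h₁.add h₂, ?_⟩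
    have h (v : TangentSpace 𝓘(ℝ, E) x) : ∀ᶠ y in 𝓝 x,
        pullbackCov φ (fun y ↦ V₁ y + V₂ y) y (extend E v y) =
          pullbackCov φ V₁ y (extend E v y) + pullbackCov φ V₂ y (extend E v y) := by
      filter_upwards [h₁.eventually_diffAlong, h₂.eventually_diffAlong] with y h1 h2
      rw [pullbackCov_add h1 h2, add_apply]
    rw [pullbackCov_congr (h u), pullbackCov_congr (h v),
      pullbackCov_add (diffAlong_pullbackCov hφ h₁ (hext _)) (diffAlong_pullbackCov hφ h₂ (hext _)),
      pullbackCov_add (diffAlong_pullbackCov hφ h₁ (hext _)) (diffAlong_pullbackCov hφ h₂ (hext _)),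
      curvature_add_right, ← e₁, ← e₂, add_apply, add_apply]
    abel
  · rintro f V₁ hf ⟨h₁, e₁⟩
    refine ⟨h₁.smul hf, ?_⟩
    have hfx : MDiffAt f x := hf.mdifferentiableAt (by simp)
    have h (v : TangentSpace 𝓘(ℝ, E) x) : ∀ᶠ y in 𝓝 x,
        pullbackCov φ (fun y ↦ f y • V₁ y) y (extend E v y) =
          f y • pullbackCov φ V₁ y (extend E v y) +
            mvfderiv 𝓘(ℝ, E) f y (extend E v y) • V₁ y := by
      filter_upwards [h₁.eventually_diffAlong, eventually_mdifferentiableAt hf (by norm_num)]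
        with y h1 h2
      rw [pullbackCov_smul h2 h1]
    -- Of the four product-rule terms, the two mixed ones are exchanged by `u ↔ v` and the Hessian
    -- of `f` is symmetric, so all three vanish after antisymmetrizing: curvature is linear over
    -- functions.
    have h2 (u v : TangentSpace 𝓘(ℝ, E) x) :
        pullbackCov φ (fun y ↦ pullbackCov φ (fun y ↦ f y • V₁ y) y (extend E v y)) x u =
          f x • pullbackCov φ (fun y ↦ pullbackCov φ V₁ y (extend E v y)) x u +
          mvfderiv 𝓘(ℝ, E) f x u • pullbackCov φ V₁ x v +
          (mvfderiv 𝓘(ℝ, E) f x v • pullbackCov φ V₁ x u +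
          mvfderiv 𝓘(ℝ, E) (fun y ↦ mvfderiv 𝓘(ℝ, E) f y (extend E v y)) x u • V₁ x) := by
      have hd := mdifferentiableAt_mvfderiv_apply hf (hext v)
      have hp := diffAlong_pullbackCov hφ h₁ (hext v)
      rw [pullbackCov_congr (h v), pullbackCov_add (hp.smul hfx) (h₁.diffAlong.smul hd), add_apply,
        pullbackCov_smul hfx hp, pullbackCov_smul hd h₁.diffAlong, extend_apply_self]
    rw [h2, h2, curvature_smul_right, ← e₁, mvfderiv_mvfderiv_extend_comm hf u v, smul_sub]
    abel
  · intro w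
    refine ⟨C2Along.comp ((hφ x).of_le (WithTop.coe_le_coe.2 le_top))
      (contMDiffAt_extend _ _ w), ?_⟩
    rw [pullbackCov_pullbackCov_comp_sub hφ w u v]
    beta_reduce
    rw [extend_apply_self]

end Hessian

/-! ### Isometric immersions and hypersurfaces. -/

section Hypersurface

variable {E : Type*} [NormedAddCommGroup E] [NormedSpace ℝ E] [FiniteDimensional ℝ E]
  {M : Type*} [TopologicalSpace M] [ChartedSpace E M] [IsManifold 𝓘(ℝ, E) ∞ M]
  [RiemannianBundle (fun x : M ↦ TangentSpace 𝓘(ℝ, E) x)]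
  [IsContMDiffRiemannianBundle 𝓘(ℝ, E) ∞ E (fun x : M ↦ TangentSpace 𝓘(ℝ, E) x)]
  {F : Type*} [NormedAddCommGroup F] [NormedSpace ℝ F] [FiniteDimensional ℝ F]
  {N : Type*} [TopologicalSpace N] [ChartedSpace F N] [IsManifold 𝓘(ℝ, F) ∞ N]
  [RiemannianBundle (fun y : N ↦ TangentSpace 𝓘(ℝ, F) y)]
  [IsContMDiffRiemannianBundle 𝓘(ℝ, F) ∞ F (fun y : N ↦ TangentSpace 𝓘(ℝ, F) y)]
  {φ : M → N} {V ξ : Π x : M, TangentSpace 𝓘(ℝ, F) (φ x)} {x : M}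
  {Y Z : Π x : M, TangentSpace 𝓘(ℝ, E) x}

/-- The terms containing `df` in the two Leibniz rules cancel. Tensoriality allows the extension
fixed in the definition to be replaced by any differentiable field, such as a member of an
orthonormal frame. -/
lemma tensorialAt_secondFundamentalForm (hφ : ContMDiff 𝓘(ℝ, E) 𝓘(ℝ, F) ∞ φ)
    (u : TangentSpace 𝓘(ℝ, E) x) : TensorialAt 𝓘(ℝ, E) E (fun Y : Π x : M, TangentSpace 𝓘(ℝ, E) x ↦
      pullbackCov φ (fun y ↦ mfderiv 𝓘(ℝ, E) 𝓘(ℝ, F) φ y (Y y)) x u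
        - mfderiv 𝓘(ℝ, E) 𝓘(ℝ, F) φ x (leviCivita M Y x u)) x where
  smul {f Y} hf hY := by
    have h := pullbackCov_smul hf (diffAlong_mfderiv hφ hY) u
    rw [leviCivita_smul hf hY]
    simp only [Pi.smul_apply', map_smul, h, add_apply, smul_apply,
      ContinuousLinearMap.smulRight_apply, map_add, smul_sub]
    abel
  add {Y Y'} hY hY' := by
    have h := pullbackCov_add (diffAlong_mfderiv hφ hY) (diffAlong_mfderiv hφ hY')
    rw [leviCivita_add hY hY']
    simp only [Pi.add_apply, map_add, h, add_apply]
    abel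

lemma tensorialAt_secondCov (hφ : ContMDiff 𝓘(ℝ, E) 𝓘(ℝ, F) ∞ φ) (hV : C2Along E F φ V x)
    (u : TangentSpace 𝓘(ℝ, E) x) : TensorialAt 𝓘(ℝ, E) E (fun Y : Π x : M, TangentSpace 𝓘(ℝ, E) x ↦
      pullbackCov φ (fun y ↦ pullbackCov φ V y (Y y)) x u
        - pullbackCov φ V x (leviCivita M Y x u)) x where
  smul {f Y} hf hY := by
    have h := pullbackCov_smul hf (diffAlong_pullbackCov hφ hV hY) u
    rw [leviCivita_smul hf hY]
    simp only [Pi.smul_apply', map_smul, h, add_apply, smul_apply,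
      ContinuousLinearMap.smulRight_apply, map_add, smul_sub]
    abel
  add {Y Y'} hY hY' := by
    have h := pullbackCov_add (diffAlong_pullbackCov hφ hV hY) (diffAlong_pullbackCov hφ hV hY')
    rw [leviCivita_add hY hY']
    simp only [Pi.add_apply, map_add, h, add_apply]
    abel

lemma secondFundamentalForm_eq (hφ : ContMDiff 𝓘(ℝ, E) 𝓘(ℝ, F) ∞ φ) (hY : MDiffAt (T% Y) x)
    (u : TangentSpace 𝓘(ℝ, E) x) : secondFundamentalForm E F φ x u (Y x) =
      pullbackCov φ (fun y ↦ mfderiv 𝓘(ℝ, E) 𝓘(ℝ, F) φ y (Y y)) x u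
        - mfderiv 𝓘(ℝ, E) 𝓘(ℝ, F) φ x (leviCivita M Y x u) :=
  (tensorialAt_secondFundamentalForm hφ u).mkHom_apply hY

lemma secondCov_eq (hφ : ContMDiff 𝓘(ℝ, E) 𝓘(ℝ, F) ∞ φ) (hV : C2Along E F φ V x)
    (hY : MDiffAt (T% Y) x) (u : TangentSpace 𝓘(ℝ, E) x) : secondCov φ V x u (Y x) =
      pullbackCov φ (fun y ↦ pullbackCov φ V y (Y y)) x u
        - pullbackCov φ V x (leviCivita M Y x u) :=
  (tensorialAt_secondCov hφ hV u).mkHom_apply hY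

lemma secondFundamentalForm_comm (hφ : ContMDiff 𝓘(ℝ, E) 𝓘(ℝ, F) ∞ φ)
    (u v : TangentSpace 𝓘(ℝ, E) x) :
    secondFundamentalForm E F φ x u v = secondFundamentalForm E F φ x v u := by
  rw [secondFundamentalForm, secondFundamentalForm, pullbackCov_mfderiv_extend_comm hφ,
    leviCivita_extend_comm]

/-- The bilinear form `(u, v) ↦ ⟨B_φ(u, v), w⟩`. -/
def secondFundamentalFormInner (hφ : ContMDiff 𝓘(ℝ, E) 𝓘(ℝ, F) ∞ φ)
    (w : TangentSpace 𝓘(ℝ, F) (φ x)) :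
    TangentSpace 𝓘(ℝ, E) x →ₗ[ℝ] TangentSpace 𝓘(ℝ, E) x →ₗ[ℝ] ℝ :=
  LinearMap.mk₂ ℝ (fun u v ↦ (inner ℝ (secondFundamentalForm E F φ x u v) w : ℝ))
    (fun u u' v ↦ by
      rw [← inner_add_left]
      simp only [secondFundamentalForm, map_add]
      congr 1
      abel)
    (fun c u v ↦ by
      rw [smul_eq_mul, ← real_inner_smul_left]
      simp only [secondFundamentalForm, map_smul, smul_sub])
    (fun u v v' ↦ by
      rw [← inner_add_left]
      congr 1
      exact map_add (TensorialAt.mkHom _ x (tensorialAt_secondFundamentalForm hφ u)) v v')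
    (fun c u v ↦ by
      rw [smul_eq_mul, ← real_inner_smul_left]
      congr 1
      exact map_smul (TensorialAt.mkHom _ x (tensorialAt_secondFundamentalForm hφ u)) c v)

lemma secondFundamentalFormInner_apply (hφ : ContMDiff 𝓘(ℝ, E) 𝓘(ℝ, F) ∞ φ)
    (w : TangentSpace 𝓘(ℝ, F) (φ x)) (u v : TangentSpace 𝓘(ℝ, E) x) :
    secondFundamentalFormInner hφ w u v = inner ℝ (secondFundamentalForm E F φ x u v) w := rfl

lemma secondCov_smul_right (hφ : ContMDiff 𝓘(ℝ, E) 𝓘(ℝ, F) ∞ φ) (hV : C2Along E F φ V x)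
    (c : ℝ) (u v : TangentSpace 𝓘(ℝ, E) x) :
    secondCov φ V x u (c • v) = c • secondCov φ V x u v :=
  map_smul (TensorialAt.mkHom _ x (tensorialAt_secondCov hφ hV u)) c v

lemma secondCov_add_right (hφ : ContMDiff 𝓘(ℝ, E) 𝓘(ℝ, F) ∞ φ) (hV : C2Along E F φ V x)
    (u v v' : TangentSpace 𝓘(ℝ, E) x) :
    secondCov φ V x u (v + v') = secondCov φ V x u v + secondCov φ V x u v' :=
  map_add (TensorialAt.mkHom _ x (tensorialAt_secondCov hφ hV u)) v v'

/-- The bilinear form `(v, w) ↦ ⟨∇̄²V(u, v), dφ w⟩`. -/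
def secondCovInner (hφ : ContMDiff 𝓘(ℝ, E) 𝓘(ℝ, F) ∞ φ) (hV : C2Along E F φ V x)
    (u : TangentSpace 𝓘(ℝ, E) x) :
    TangentSpace 𝓘(ℝ, E) x →ₗ[ℝ] TangentSpace 𝓘(ℝ, E) x →ₗ[ℝ] ℝ :=
  LinearMap.mk₂ ℝ (fun v w ↦
      (inner ℝ (secondCov φ V x u v) (mfderiv 𝓘(ℝ, E) 𝓘(ℝ, F) φ x w) : ℝ))
    (fun v v' w ↦ by rw [secondCov_add_right hφ hV, inner_add_left])
    (fun c v w ↦ by rw [secondCov_smul_right hφ hV, real_inner_smul_left, smul_eq_mul])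
    (fun v w w' ↦ by rw [map_add, inner_add_right])
    (fun c v w ↦ by rw [map_smul, real_inner_smul_right, smul_eq_mul])

lemma mvfderiv_sum {ι : Type*} (s : Finset ι) {f : ι → M → ℝ} (hf : ∀ i, MDiffAt (f i) x)
    (v : TangentSpace 𝓘(ℝ, E) x) : mvfderiv 𝓘(ℝ, E) (fun y ↦ ∑ i ∈ s, f i y) x v =
      ∑ i ∈ s, mvfderiv 𝓘(ℝ, E) (f i) x v := by
  classical
  suffices h : MDiffAt (fun y ↦ ∑ i ∈ s, f i y) x ∧ mvfderiv 𝓘(ℝ, E) (fun y ↦ ∑ i ∈ s, f i y) x v =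
      ∑ i ∈ s, mvfderiv 𝓘(ℝ, E) (f i) x v from h.2
  induction s using Finset.induction_on with
  | empty => simpa using ⟨mdifferentiableAt_const, by rw [mvfderiv_const]; rfl⟩
  | insert a s ha ih =>
    simp only [Finset.sum_insert ha]
    exact ⟨(hf a).add ih.1, by rw [mvfderiv_fun_add (hf a) ih.1, add_apply, ih.2]⟩

/-- The second fundamental form of an isometric immersion is normal. -/
lemma IsIsometricImmersion.inner_secondFundamentalForm (hφ : IsIsometricImmersion E F φ)
    (u v w : TangentSpace 𝓘(ℝ, E) x) :
    (inner ℝ (secondFundamentalForm E F φ x u v) (mfderiv 𝓘(ℝ, E) 𝓘(ℝ, F) φ x w) : ℝ) = 0 := by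
  set β : TangentSpace 𝓘(ℝ, E) x → TangentSpace 𝓘(ℝ, E) x → TangentSpace 𝓘(ℝ, E) x → ℝ :=
    fun u v w ↦ inner ℝ (secondFundamentalForm E F φ x u v) (mfderiv 𝓘(ℝ, E) 𝓘(ℝ, F) φ x w)
    with hβ
  have hs (u v w) : β u v w = β v u w := by
    simp only [hβ, secondFundamentalForm_comm hφ.contMDiff u v]
  have ha (u v w) : β u v w = -β u w v := by
    have hv := mdifferentiableAt_extend 𝓘(ℝ, E) E v
    have hw := mdifferentiableAt_extend 𝓘(ℝ, E) E w
    have h1 := mvfderiv_inner hv hw u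
    have h2 := mvfderiv_inner_along (diffAlong_mfderiv hφ.contMDiff hv)
      (diffAlong_mfderiv hφ.contMDiff hw) u
    simp only [hφ.inner_mfderiv, extend_apply_self] at h1 h2
    rw [h1] at h2
    simp only [hβ, secondFundamentalForm, inner_sub_left, hφ.inner_mfderiv]
    rw [real_inner_comm v, real_inner_comm (mfderiv 𝓘(ℝ, E) 𝓘(ℝ, F) φ x v)]
    linarith
  -- A trilinear form symmetric in its first two slots and skew in its last two is zero: six
  -- alternating exchanges return to the original order with the opposite sign.
  have := ha u v w
  have := hs u w v
  have := ha w u v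
  have := hs w v u
  have := ha v w u
  have := hs v u w
  change β u v w = 0
  linarith

/-! ### The unit normal field: shape operator, Laplacian and bitension. -/

section Normal

variable (hφ : IsIsometricImmersion E F φ) (hξ : IsUnitNormalField E F φ ξ)

include hξ in
lemma IsUnitNormalField.c2Along : C2Along E F φ ξ x :=
  (hξ.contMDiff x).of_le (WithTop.coe_le_coe.2 le_top)

include hξ in
lemma IsUnitNormalField.inner_mfderiv_eq_zero' (u : TangentSpace 𝓘(ℝ, E) x) :
    (inner ℝ (ξ x) (mfderiv 𝓘(ℝ, E) 𝓘(ℝ, F) φ x u) : ℝ) = 0 := by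
  rw [real_inner_comm, hξ.inner_mfderiv_eq_zero]

include hξ in
lemma IsUnitNormalField.inner_self : (inner ℝ (ξ x) (ξ x) : ℝ) = 1 := by
  rw [real_inner_self_eq_norm_sq, hξ.norm_eq_one, one_pow]

include hξ in
lemma IsUnitNormalField.inner_pullbackCov (u : TangentSpace 𝓘(ℝ, E) x) :
    (inner ℝ (pullbackCov φ ξ x u) (ξ x) : ℝ) = 0 := by
  have h := mvfderiv_inner_along (hξ.c2Along (x := x)).diffAlong hξ.c2Along.diffAlong u
  simp only [hξ.inner_self] at h
  rw [mvfderiv_const, real_inner_comm (pullbackCov φ ξ x u)] at h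
  change (0 : ℝ) = _ at h
  linarith

include hφ hξ in
-- Weingarten relation, from differentiating `⟨dφ V, ξ⟩ = 0`. With the symmetry of `B_φ` it makes
-- `∇̄ξ` a self-adjoint tangential operator.
lemma inner_pullbackCov_mfderiv (u v : TangentSpace 𝓘(ℝ, E) x) :
    (inner ℝ (pullbackCov φ ξ x u) (mfderiv 𝓘(ℝ, E) 𝓘(ℝ, F) φ x v) : ℝ) =
      -inner ℝ (secondFundamentalForm E F φ x u v) (ξ x) := by
  have h := mvfderiv_inner_along (diffAlong_mfderiv hφ.contMDiff
    (mdifferentiableAt_extend 𝓘(ℝ, E) E v)) (hξ.c2Along (x := x)).diffAlong u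
  simp only [hξ.inner_mfderiv_eq_zero, extend_apply_self] at h
  rw [mvfderiv_const] at h
  change (0 : ℝ) = _ at h
  rw [secondFundamentalForm, inner_sub_left, hξ.inner_mfderiv_eq_zero,
    real_inner_comm (mfderiv 𝓘(ℝ, E) 𝓘(ℝ, F) φ x v)]
  linarith

include hφ hξ in
lemma inner_pullbackCov_mfderiv_comm (u v : TangentSpace 𝓘(ℝ, E) x) :
    (inner ℝ (pullbackCov φ ξ x u) (mfderiv 𝓘(ℝ, E) 𝓘(ℝ, F) φ x v) : ℝ) =
      inner ℝ (pullbackCov φ ξ x v) (mfderiv 𝓘(ℝ, E) 𝓘(ℝ, F) φ x u) := by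
  rw [inner_pullbackCov_mfderiv hφ hξ, inner_pullbackCov_mfderiv hφ hξ,
    secondFundamentalForm_comm hφ.contMDiff]

variable (hdim : Module.finrank ℝ F = Module.finrank ℝ E + 1)

/-- The orthonormal basis of `T_{φ x} N` formed by `dφ e_i` and `ξ x`. -/
def adaptedBasis {ι : Type*} [Fintype ι] (b : OrthonormalBasis ι ℝ (TangentSpace 𝓘(ℝ, E) x)) :
    OrthonormalBasis (Option ι) ℝ (TangentSpace 𝓘(ℝ, F) (φ x)) :=
  orthonormalBasisOfCard
    (v := fun i : Option ι ↦ i.elim (ξ x) fun i ↦ mfderiv 𝓘(ℝ, E) 𝓘(ℝ, F) φ x (b i))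
    (by
      classical
      rw [orthonormal_iff_ite]
      rintro (_ | i) (_ | j)
      · simp [hξ.norm_eq_one]
      · simpa [real_inner_comm] using hξ.inner_mfderiv_eq_zero x (b j)
      · simpa using hξ.inner_mfderiv_eq_zero x (b i)
      · simpa [hφ.inner_mfderiv] using orthonormal_iff_ite.1 b.orthonormal i j)
    (by
      have h := Module.finrank_eq_card_basis b.toBasis
      rw [Fintype.card_option, ← h]
      exact hdim.symm)

lemma adaptedBasis_none {ι : Type*} [Fintype ι]
    (b : OrthonormalBasis ι ℝ (TangentSpace 𝓘(ℝ, E) x)) :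
    adaptedBasis hφ hξ hdim b none = ξ x := by
  simp [adaptedBasis]

lemma adaptedBasis_some {ι : Type*} [Fintype ι]
    (b : OrthonormalBasis ι ℝ (TangentSpace 𝓘(ℝ, E) x)) (i : ι) :
    adaptedBasis hφ hξ hdim b (some i) = mfderiv 𝓘(ℝ, E) 𝓘(ℝ, F) φ x (b i) := by
  simp [adaptedBasis]

include hφ hξ hdim

lemma ext_adapted {a a' : TangentSpace 𝓘(ℝ, F) (φ x)}
    (h : ∀ u, (inner ℝ a (mfderiv 𝓘(ℝ, E) 𝓘(ℝ, F) φ x u) : ℝ) =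
      inner ℝ a' (mfderiv 𝓘(ℝ, E) 𝓘(ℝ, F) φ x u))
    (hn : (inner ℝ a (ξ x) : ℝ) = inner ℝ a' (ξ x)) : a = a' := by
  refine (adaptedBasis hφ hξ hdim
    (stdOrthonormalBasis ℝ (TangentSpace 𝓘(ℝ, E) x))).repr.injective (PiLp.ext ?_)
  simp only [OrthonormalBasis.repr_apply_apply]
  rintro (_ | i)
  · rwa [adaptedBasis_none, real_inner_comm, real_inner_comm a']
  · rw [adaptedBasis_some, real_inner_comm, real_inner_comm a', h]

lemma eq_smul_of_normal {a : TangentSpace 𝓘(ℝ, F) (φ x)}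
    (h : ∀ u, (inner ℝ a (mfderiv 𝓘(ℝ, E) 𝓘(ℝ, F) φ x u) : ℝ) = 0) :
    a = (inner ℝ a (ξ x) : ℝ) • ξ x := by
  refine ext_adapted hφ hξ hdim (fun u ↦ ?_) ?_
  · rw [h, real_inner_smul_left, hξ.inner_mfderiv_eq_zero', mul_zero]
  · rw [real_inner_smul_left, hξ.inner_self, mul_one]

lemma secondFundamentalForm_eq_smul (u v : TangentSpace 𝓘(ℝ, E) x) :
    secondFundamentalForm E F φ x u v =
      (inner ℝ (secondFundamentalForm E F φ x u v) (ξ x) : ℝ) • ξ x :=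
  eq_smul_of_normal hφ hξ hdim (hφ.inner_secondFundamentalForm u v)

lemma tension_eq_smul : tension E F φ x = (inner ℝ (tension E F φ x) (ξ x) : ℝ) • ξ x := by
  refine eq_smul_of_normal hφ hξ hdim fun u ↦ ?_
  rw [tension, sum_inner]
  exact Finset.sum_eq_zero fun i _ ↦ hφ.inner_secondFundamentalForm _ _ _

/-- Product rule in which the term `⟨∇̄_Y ξ, B_φ(u, Z)⟩` drops out: `∇̄_Y ξ` is orthogonal to `ξ`,
and `B_φ` is a multiple of `ξ`. What remains is the covariant derivative of the shape operator up to
sign, hence symmetric in `Y, Z`. -/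
lemma inner_secondCov_mfderiv (hY : MDiffAt (T% Y) x) (hZ : MDiffAt (T% Z) x)
    (u : TangentSpace 𝓘(ℝ, E) x) :
    (inner ℝ (secondCov φ ξ x u (Y x)) (mfderiv 𝓘(ℝ, E) 𝓘(ℝ, F) φ x (Z x)) : ℝ) =
      mvfderiv 𝓘(ℝ, E) (fun y ↦ (inner ℝ (pullbackCov φ ξ y (Y y))
        (mfderiv 𝓘(ℝ, E) 𝓘(ℝ, F) φ y (Z y)) : ℝ)) x u -
      inner ℝ (pullbackCov φ ξ x (Y x)) (mfderiv 𝓘(ℝ, E) 𝓘(ℝ, F) φ x (leviCivita M Z x u)) -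
      inner ℝ (pullbackCov φ ξ x (leviCivita M Y x u)) (mfderiv 𝓘(ℝ, E) 𝓘(ℝ, F) φ x (Z x)) := by
  have h1 : (inner ℝ (pullbackCov φ ξ x (Y x)) (secondFundamentalForm E F φ x u (Z x)) : ℝ) = 0 := by
    rw [secondFundamentalForm_eq_smul hφ hξ hdim, real_inner_smul_right, hξ.inner_pullbackCov,
      mul_zero]
  rw [secondFundamentalForm_eq hφ.contMDiff hZ, inner_sub_right, sub_eq_zero] at h1
  rw [secondCov_eq hφ.contMDiff hξ.c2Along hY, inner_sub_left, mvfderiv_inner_along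
    (diffAlong_pullbackCov hφ.contMDiff hξ.c2Along hY) (diffAlong_mfderiv hφ.contMDiff hZ), h1]
  ring

lemma inner_secondCov_mfderiv_comm (u v w : TangentSpace 𝓘(ℝ, E) x) :
    (inner ℝ (secondCov φ ξ x u v) (mfderiv 𝓘(ℝ, E) 𝓘(ℝ, F) φ x w) : ℝ) =
      inner ℝ (secondCov φ ξ x u w) (mfderiv 𝓘(ℝ, E) 𝓘(ℝ, F) φ x v) := by
  have hv := mdifferentiableAt_extend 𝓘(ℝ, E) E v
  have hw := mdifferentiableAt_extend 𝓘(ℝ, E) E w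
  have h1 := inner_secondCov_mfderiv hφ hξ hdim hv hw u
  have h2 := inner_secondCov_mfderiv hφ hξ hdim hw hv u
  have hsymm : (fun y ↦ (inner ℝ (pullbackCov φ ξ y (extend E v y))
      (mfderiv 𝓘(ℝ, E) 𝓘(ℝ, F) φ y (extend E w y)) : ℝ)) = fun y ↦
      (inner ℝ (pullbackCov φ ξ y (extend E w y))
        (mfderiv 𝓘(ℝ, E) 𝓘(ℝ, F) φ y (extend E v y)) : ℝ) :=
    funext fun y ↦ inner_pullbackCov_mfderiv_comm hφ hξ _ _
  rw [hsymm] at h1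
  simp only [extend_apply_self] at h1 h2
  rw [h1, h2, inner_pullbackCov_mfderiv_comm hφ hξ v,
    inner_pullbackCov_mfderiv_comm hφ hξ w]
  ring

omit hφ hdim in
-- Obtained by differentiating `⟨∇̄_v ξ, ξ⟩ = 0`.
lemma inner_secondCov_normal (hφ : ContMDiff 𝓘(ℝ, E) 𝓘(ℝ, F) ∞ φ) (u v : TangentSpace 𝓘(ℝ, E) x) :
    (inner ℝ (secondCov φ ξ x u v) (ξ x) : ℝ) =
      -inner ℝ (pullbackCov φ ξ x u) (pullbackCov φ ξ x v) := by
  have h := mvfderiv_inner_along (diffAlong_pullbackCov hφ (hξ.c2Along (x := x))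
    (mdifferentiableAt_extend 𝓘(ℝ, E) E v)) hξ.c2Along.diffAlong u
  simp only [hξ.inner_pullbackCov, extend_apply_self] at h
  rw [mvfderiv_const] at h
  change (0 : ℝ) = _ at h
  rw [secondCov, inner_sub_left, hξ.inner_pullbackCov,
    real_inner_comm (pullbackCov φ ξ x v) (pullbackCov φ ξ x u)]
  linarith

/-- The divergence of the shape operator in the form `∑ i, ⟨∇̄²ξ(u, e_i), dφ e_i⟩` vanishes if the
normal component of the tension field is constant. -/
lemma sum_inner_secondCov_mfderiv {c : ℝ} (hc : ∀ y, (inner ℝ (tension E F φ y) (ξ y) : ℝ) = c)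
    {ι : Type*} [Fintype ι] (b : OrthonormalBasis ι ℝ (TangentSpace 𝓘(ℝ, E) x))
    (u : TangentSpace 𝓘(ℝ, E) x) :
    ∑ i, (inner ℝ (secondCov φ ξ x u (b i)) (mfderiv 𝓘(ℝ, E) 𝓘(ℝ, F) φ x (b i)) : ℝ) = 0 := by
  -- The trace must be differentiated, so the pointwise basis `b` is exchanged for a smooth
  -- orthonormal frame.
  obtain ⟨s, hs, hon⟩ := exists_orthonormal_frame (E := E) x
  have hsd (i) : MDiffAt (T% (s i)) x := (hs i).mdifferentiableAt (by simp)
  have hcard (y : M) : Fintype.card (Fin (Module.finrank ℝ E)) =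
      Module.finrank ℝ (TangentSpace 𝓘(ℝ, E) y) := Fintype.card_fin _
  have hb (i) : orthonormalBasisOfCard hon.self_of_nhds (hcard x) i = s i x := by simp
  refine (sum_bilin_orthonormalBasis_eq (secondCovInner hφ.contMDiff hξ.c2Along u) b
    (orthonormalBasisOfCard hon.self_of_nhds (hcard x))).trans ?_
  simp only [hb]
  change ∑ i, (inner ℝ (secondCov φ ξ x u (s i x))
    (mfderiv 𝓘(ℝ, E) 𝓘(ℝ, F) φ x (s i x)) : ℝ) = 0
  simp only [inner_secondCov_mfderiv hφ hξ hdim (hsd _) (hsd _),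
    inner_pullbackCov_mfderiv_comm hφ hξ (leviCivita M (s _) x u), sub_sub, ← two_mul,
    Finset.sum_sub_distrib, ← Finset.mul_sum]
  have hd (i) : MDiffAt (fun y ↦ (inner ℝ (pullbackCov φ ξ y (s i y))
      (mfderiv 𝓘(ℝ, E) 𝓘(ℝ, F) φ y (s i y)) : ℝ)) x :=
    (diffAlong_pullbackCov hφ.contMDiff hξ.c2Along (hsd i)).inner
      (diffAlong_mfderiv hφ.contMDiff (hsd i))
  -- Near `x` the trace of `∇̄ξ` in the frame is `-⟨τ(φ), ξ⟩ = -c`.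
  have h1 : ∑ i, mvfderiv 𝓘(ℝ, E) (fun y ↦ (inner ℝ (pullbackCov φ ξ y (s i y))
      (mfderiv 𝓘(ℝ, E) 𝓘(ℝ, F) φ y (s i y)) : ℝ)) x u = 0 := by
    rw [← mvfderiv_sum _ hd, mvfderiv_congr (g := fun _ ↦ -c), mvfderiv_const]
    · rfl
    filter_upwards [hon] with y hy
    have hb' (i) : orthonormalBasisOfCard hy (hcard y) i = s i y := by simp
    have h := sum_bilin_orthonormalBasis_eq (secondFundamentalFormInner hφ.contMDiff (ξ y))
      (stdOrthonormalBasis ℝ (TangentSpace 𝓘(ℝ, E) y)) (orthonormalBasisOfCard hy (hcard y))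
    simp only [secondFundamentalFormInner_apply, hb'] at h
    rw [← sum_inner] at h
    simp only [inner_pullbackCov_mfderiv hφ hξ, Finset.sum_neg_distrib, ← h]
    rw [← hc y, tension]
  -- The connection coefficients `⟨s_j, ∇_u s_i⟩` are skew in `i, j` by orthonormality and are
  -- contracted with the symmetric shape operator; the sum equals its own negative.
  have h2 : ∑ i, (inner ℝ (pullbackCov φ ξ x (s i x))
      (mfderiv 𝓘(ℝ, E) 𝓘(ℝ, F) φ x (leviCivita M (s i) x u)) : ℝ) = 0 := by
    have hanti (i j) : (inner ℝ (s j x) (leviCivita M (s i) x u) : ℝ) =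
        -inner ℝ (s i x) (leviCivita M (s j) x u) := by
      have h := mvfderiv_inner (hsd i) (hsd j) u
      rw [mvfderiv_congr (g := fun _ ↦ (if i = j then (1 : ℝ) else 0))
        (hon.mono fun y hy ↦ orthonormal_iff_ite.1 hy i j), mvfderiv_const] at h
      change (0 : ℝ) = _ at h
      rw [real_inner_comm (leviCivita M (s i) x u)]
      linarith
    have hexp (i) : (inner ℝ (pullbackCov φ ξ x (s i x))
        (mfderiv 𝓘(ℝ, E) 𝓘(ℝ, F) φ x (leviCivita M (s i) x u)) : ℝ) =
        ∑ j, inner ℝ (s j x) (leviCivita M (s i) x u) * inner ℝ (pullbackCov φ ξ x (s i x))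
          (mfderiv 𝓘(ℝ, E) 𝓘(ℝ, F) φ x (s j x)) := by
      conv_lhs => rw [← (orthonormalBasisOfCard hon.self_of_nhds (hcard x)).sum_repr'
        (leviCivita M (s i) x u)]
      simp only [hb, map_sum, map_smul, inner_sum, real_inner_smul_right]
    have hneg : ∑ i, (inner ℝ (pullbackCov φ ξ x (s i x))
        (mfderiv 𝓘(ℝ, E) 𝓘(ℝ, F) φ x (leviCivita M (s i) x u)) : ℝ) =
        -∑ i, (inner ℝ (pullbackCov φ ξ x (s i x))
          (mfderiv 𝓘(ℝ, E) 𝓘(ℝ, F) φ x (leviCivita M (s i) x u)) : ℝ) := by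
      simp only [hexp, ← Finset.sum_neg_distrib]
      rw [Finset.sum_comm]
      refine Finset.sum_congr rfl fun i _ ↦ Finset.sum_congr rfl fun j _ ↦ ?_
      rw [hanti, inner_pullbackCov_mfderiv_comm hφ hξ]
      ring
    linarith
  rw [h1, h2]
  ring

lemma ricciTransform_normal : ricciTransform (φ x) (ξ x) = curvatureTerm E F φ ξ x := by
  refine ext_inner_right ℝ fun z ↦ ?_
  rw [inner_ricciTransform _ _ (adaptedBasis hφ hξ hdim
    (stdOrthonormalBasis ℝ (TangentSpace 𝓘(ℝ, E) x))), Fintype.sum_option, curvatureTerm, sum_inner]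
  simp only [adaptedBasis_none, adaptedBasis_some, curvature_self, inner_zero_left, zero_add]

/-- In `⟨∇̄²ξ(e_i, e_i), dφ u⟩`, symmetry moves `u` into the second slot and the Ricci identity
moves it into the first. The first contribution sums to zero by constancy of the mean curvature;
pair symmetry identifies the curvature contribution with the Ricci transform of `ξ`. -/
lemma inner_roughLaplacian_mfderiv {c : ℝ}
    (hc : ∀ y, (inner ℝ (tension E F φ y) (ξ y) : ℝ) = c) (u : TangentSpace 𝓘(ℝ, E) x) :
    (inner ℝ (roughLaplacian E F φ ξ x) (mfderiv 𝓘(ℝ, E) 𝓘(ℝ, F) φ x u) : ℝ) =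
      -inner ℝ (ricciTransform (φ x) (ξ x)) (mfderiv 𝓘(ℝ, E) 𝓘(ℝ, F) φ x u) := by
  set b := stdOrthonormalBasis ℝ (TangentSpace 𝓘(ℝ, E) x)
  have h (i) : (inner ℝ (secondCov φ ξ x (b i) (b i)) (mfderiv 𝓘(ℝ, E) 𝓘(ℝ, F) φ x u) : ℝ) =
      inner ℝ (secondCov φ ξ x u (b i)) (mfderiv 𝓘(ℝ, E) 𝓘(ℝ, F) φ x (b i)) +
      inner ℝ (curvature (φ x) (ξ x) (mfderiv 𝓘(ℝ, E) 𝓘(ℝ, F) φ x (b i))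
        (mfderiv 𝓘(ℝ, E) 𝓘(ℝ, F) φ x (b i))) (mfderiv 𝓘(ℝ, E) 𝓘(ℝ, F) φ x u) := by
    rw [inner_secondCov_mfderiv_comm hφ hξ hdim, inner_curvature_pair_symm,
      ← secondCov_sub_secondCov hφ.contMDiff hξ.c2Along, inner_sub_left]
    ring
  rw [ricciTransform_normal hφ hξ hdim, roughLaplacian, curvatureTerm, inner_neg_left, sum_inner,
    sum_inner]
  simp only [b, h, Finset.sum_add_distrib, sum_inner_secondCov_mfderiv hφ hξ hdim hc, zero_add]

/-- Parseval in the adapted basis: `∇̄_{e_i} ξ` has no `ξ`-component, and its tangential components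
are, up to sign, the coefficients of `B_φ`. No assumption on the mean curvature enters. -/
lemma inner_roughLaplacian_normal :
    (inner ℝ (roughLaplacian E F φ ξ x) (ξ x) : ℝ) = normSqSecondFundamentalForm E F φ x := by
  rw [roughLaplacian, inner_neg_left, sum_inner, normSqSecondFundamentalForm,
    ← Finset.sum_neg_distrib]
  refine Finset.sum_congr rfl fun i _ ↦ ?_
  rw [inner_secondCov_normal hξ hφ.contMDiff, neg_neg, ← (adaptedBasis hφ hξ hdim
    (stdOrthonormalBasis ℝ (TangentSpace 𝓘(ℝ, E) x))).sum_inner_mul_inner, Fintype.sum_option]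
  simp only [adaptedBasis_none, adaptedBasis_some, hξ.inner_pullbackCov, zero_mul, zero_add]
  refine Finset.sum_congr rfl fun j _ ↦ ?_
  rw [real_inner_comm (pullbackCov φ ξ x _) (mfderiv 𝓘(ℝ, E) 𝓘(ℝ, F) φ x _),
    inner_pullbackCov_mfderiv hφ hξ, secondFundamentalForm_eq_smul hφ hξ hdim, norm_smul,
    hξ.norm_eq_one, mul_one, Real.norm_eq_abs, sq_abs, real_inner_smul_left, hξ.inner_self]
  ring

omit hφ hdim in
lemma roughLaplacian_const_smul (hφ : ContMDiff 𝓘(ℝ, E) 𝓘(ℝ, F) ∞ φ) (c : ℝ) :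
    roughLaplacian E F φ (fun y ↦ c • ξ y) x = c • roughLaplacian E F φ ξ x := by
  have h {V : Π x : M, TangentSpace 𝓘(ℝ, F) (φ x)} {y : M} (hV : DiffAlong E F φ V y)
      (v : TangentSpace 𝓘(ℝ, E) y) :
      pullbackCov φ (fun y ↦ c • V y) y v = c • pullbackCov φ V y v := by
    have h := pullbackCov_smul (f := fun _ ↦ c) mdifferentiableAt_const hV v
    rw [mvfderiv_const] at h
    exact h.trans (by simp)
  have h2 (u v : TangentSpace 𝓘(ℝ, E) x) :
      secondCov φ (fun y ↦ c • ξ y) x u v = c • secondCov φ ξ x u v := by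
    simp only [secondCov, h (hξ.c2Along (x := _)).diffAlong, smul_sub]
    rw [h (diffAlong_pullbackCov hφ hξ.c2Along (mdifferentiableAt_extend 𝓘(ℝ, E) E v))]
  simp only [roughLaplacian, h2, smul_neg, Finset.smul_sum]

lemma bitension_eq {c : ℝ} (hc : ∀ y, (inner ℝ (tension E F φ y) (ξ y) : ℝ) = c) :
    bitension E F φ x = c • (roughLaplacian E F φ ξ x - ricciTransform (φ x) (ξ x)) := by
  have hτ : tension E F φ = fun y ↦ c • ξ y := by
    ext y
    rw [← hc y]
    exact tension_eq_smul hφ hξ hdim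
  rw [bitension, hτ, roughLaplacian_const_smul hξ hφ.contMDiff, ricciTransform_normal hφ hξ hdim, smul_sub]
  simp only [curvatureTerm, curvature_smul_left, Finset.smul_sum]

/-- A hypersurface of non-zero constant mean curvature is biharmonic iff `ρ(ξ) = ‖B_φ‖² ξ`. -/
lemma bitension_eq_zero_iff {c : ℝ} (hc : ∀ y, (inner ℝ (tension E F φ y) (ξ y) : ℝ) = c)
    (h0 : c ≠ 0) : bitension E F φ x = 0 ↔
      ricciTransform (φ x) (ξ x) = normSqSecondFundamentalForm E F φ x • ξ x := by
  rw [bitension_eq hφ hξ hdim hc, smul_eq_zero_iff_right h0, sub_eq_zero]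
  have ht (u : TangentSpace 𝓘(ℝ, E) x) := inner_roughLaplacian_mfderiv hφ hξ hdim hc u
  have hn := inner_roughLaplacian_normal (x := x) hφ hξ hdim
  constructor
  · intro h
    rw [h] at hn ht
    rw [← hn]
    -- Both identities for the tangential part give `⟨ρ(ξ), dφ u⟩ = -⟨ρ(ξ), dφ u⟩`, so `ρ(ξ)` is
    -- normal.
    exact eq_smul_of_normal hφ hξ hdim fun u ↦ by linarith [ht u]
  · intro h
    refine ext_adapted hφ hξ hdim (fun u ↦ ?_) ?_
    · rw [ht, h, real_inner_smul_left, hξ.inner_mfderiv_eq_zero', mul_zero, neg_zero]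
    · rw [hn, h, real_inner_smul_left, hξ.inner_self, mul_one]

lemma tension_eq_zero_of_normSq_nonpos (h : normSqSecondFundamentalForm E F φ x ≤ 0) :
    tension E F φ x = 0 := by
  have h1 : normSqSecondFundamentalForm E F φ x = 0 :=
    le_antisymm h (Finset.sum_nonneg fun j _ ↦ Finset.sum_nonneg fun k _ ↦ sq_nonneg _)
  rw [normSqSecondFundamentalForm, Finset.sum_eq_zero_iff_of_nonneg
    fun j _ ↦ Finset.sum_nonneg fun k _ ↦ sq_nonneg _] at h1
  refine Finset.sum_eq_zero fun i hi ↦ ?_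
  have h2 := (Finset.sum_eq_zero_iff_of_nonneg fun k _ ↦ sq_nonneg _).1 (h1 i hi) i hi
  simpa using h2

end Normal

end Hypersurface

end RiemGeom

end

/-! ### Biharmonic hypersurfaces of constant mean curvature. -/

theorem corollary3p9
    {E : Type*} [NormedAddCommGroup E] [NormedSpace ℝ E] [FiniteDimensional ℝ E]
    {M : Type*} [TopologicalSpace M] [T2Space M] [ChartedSpace E M] [IsManifold 𝓘(ℝ, E) ∞ M]
    [RiemannianBundle (fun x : M ↦ TangentSpace 𝓘(ℝ, E) x)]
    [IsContMDiffRiemannianBundle 𝓘(ℝ, E) ∞ E (fun x : M ↦ TangentSpace 𝓘(ℝ, E) x)]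
    {F : Type*} [NormedAddCommGroup F] [NormedSpace ℝ F] [FiniteDimensional ℝ F]
    {N : Type*} [TopologicalSpace N] [T2Space N] [ChartedSpace F N] [IsManifold 𝓘(ℝ, F) ∞ N]
    [RiemannianBundle (fun y : N ↦ TangentSpace 𝓘(ℝ, F) y)]
    [IsContMDiffRiemannianBundle 𝓘(ℝ, F) ∞ F (fun y : N ↦ TangentSpace 𝓘(ℝ, F) y)]
    (hdim : Module.finrank ℝ F = Module.finrank ℝ E + 1)
    (φ : M → N) (hφ : RiemGeom.IsIsometricImmersion E F φ)
    (ξ : Π x : M, TangentSpace 𝓘(ℝ, F) (φ x)) (hξ : RiemGeom.IsUnitNormalField E F φ ξ)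
    (H : ℝ) (hH : ∀ x : M, RiemGeom.meanCurvature E F φ ξ x = H) :
    (H ≠ 0 →
      (RiemGeom.IsBiharmonic E F φ ↔
        ∀ x : M, RiemGeom.ricciTransform (φ x) (ξ x) =
          RiemGeom.normSqSecondFundamentalForm E F φ x • ξ x)) ∧
    (H ≠ 0 → ∀ c : ℝ, RiemGeom.IsEinstein F N c →
      (RiemGeom.IsBiharmonic E F φ ↔
        ∀ x : M, RiemGeom.normSqSecondFundamentalForm E F φ x = c)) ∧
    (RiemGeom.HasNonposRicci F N →
      RiemGeom.IsBiharmonic E F φ → RiemGeom.IsHarmonic E F φ) := by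
  have hτ (x : M) : (inner ℝ (RiemGeom.tension E F φ x) (ξ x) : ℝ) = Module.finrank ℝ E * H := by
    rw [← hH x, RiemGeom.meanCurvature]
    rcases eq_or_ne (Module.finrank ℝ E : ℝ) 0 with h0 | h0
    -- In dimension zero the tension is an empty sum, so both sides vanish.
    · have hE : Module.finrank ℝ (TangentSpace 𝓘(ℝ, E) x) = 0 := by exact_mod_cast h0
      have : IsEmpty (Fin (Module.finrank ℝ (TangentSpace 𝓘(ℝ, E) x))) :=
        ⟨fun i ↦ absurd i.pos (by rw [hE]; exact lt_irrefl 0)⟩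
      rw [h0, zero_mul, RiemGeom.tension, Finset.univ_eq_empty, Finset.sum_empty, inner_zero_left]
    · rw [← mul_assoc, mul_one_div_cancel h0, one_mul]
  -- In dimension zero the factor `1 / m` is `1 / 0 = 0`, which forces `H = 0`; a nonzero `H` at
  -- some point thus gives `m ≠ 0`.
  have hne (hH0 : H ≠ 0) (x : M) : (Module.finrank ℝ E : ℝ) * H ≠ 0 := by
    refine mul_ne_zero (fun h0 ↦ hH0 ?_) hH0
    rw [← hH x, RiemGeom.meanCurvature, h0, div_zero, zero_mul]
  have key (hH0 : H ≠ 0) : RiemGeom.IsBiharmonic E F φ ↔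
      ∀ x : M, RiemGeom.ricciTransform (φ x) (ξ x) =
        RiemGeom.normSqSecondFundamentalForm E F φ x • ξ x :=
    (and_iff_right hφ.contMDiff).trans (forall_congr' fun x ↦
      RiemGeom.bitension_eq_zero_iff hφ hξ hdim hτ (hne hH0 x))
  refine ⟨key, fun hH0 c hc ↦ (key hH0).trans (forall_congr' fun x ↦ ?_), fun hN hbi ↦
    ⟨hφ.contMDiff, fun x ↦ ?_⟩⟩
  · have hξ0 : ξ x ≠ 0 := norm_ne_zero_iff.1 (by simp [hξ.norm_eq_one])
    rw [hc, smul_left_inj hξ0, eq_comm]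
  · rcases eq_or_ne H 0 with rfl | hH0
    · rw [RiemGeom.tension_eq_smul hφ hξ hdim, hτ, mul_zero, zero_smul]
    · refine RiemGeom.tension_eq_zero_of_normSq_nonpos hφ hξ hdim ?_
      -- Pairing `ρ(ξ) = ‖B_φ‖² ξ` with `ξ` turns the Ricci bound into `‖B_φ‖² ≤ 0`.
      have h := hN (φ x) (ξ x)
      rwa [(key hH0).1 hbi x, real_inner_smul_left, hξ.inner_self, mul_one] at h
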